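/- A generalized disk in the Euclidean plane is a closed disk of radius $r>0$ (bend $1/r$), the closed exterior of a circle of radius $r>0$ (bend $-1/r$), or a closed half-plane (bend $0$); exteriors and half-planes are regarded as also containing the point at infinity. Two generalized disks are tangent if they have exactly one point in common (possibly the point at infinity). An Apollonian gasket is the set of all generalized disks obtained from four pairwise tangent ones, at least one of which has bend $\le 0$, by repeatedly replacing one disk in a quadruple of pairwise tangent disks by a disk tangent to the other three. It is integral if all its bends are integers, and an integral gasket is irreducible if its bends have no common factor except $1$. Gaskets are identified when an isometry of the plane (possibly orientation-reversing) carries one onto the other. **Theorem.** There is a one-to-one correspondence between the irreducible integral Apollonian gaskets (up to congruence) and the quadruples of non-negative integers $(B,k,n,\mu)$ with $\gcd(B,k,n,\mu)=1$ that are solutions of $$B^2+\mu^2=kn$$ with the constraints $$\text{(i)}\quad 0\le\mu\le B/\sqrt3,\qquad \text{(ii)}\quad 2\mu\le k\le n.$$ Under this correspondence, the gasket corresponding to $(B,k,n,\mu)$ has as its quintet of major bends, i.e. its five least bends, listed in non-decreasing order and with multiplicity, $$(B_0,B_1,B_2,B_3,B_4)=(-B,\;B+k,\;B+n,\;B+k+n-2\mu,\;B+k+n+2\mu).$$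 -/

import Mathlib

namespace Apollonian

/-- The Euclidean plane. -/
abbrev Plane : Type := EuclideanSpace ℝ (Fin 2)

/-- A generalized closed disk: an ordinary closed disk, the closed exterior of a circle, or a closed
half-plane given by its outward unit normal `u` and offset `t`.  Every such object is listed exactly
once. -/
inductive Disk : Type
  | inside (c : Plane) (r : ℝ) (hr : 0 < r) : Disk
  | outside (c : Plane) (r : ℝ) (hr : 0 < r) : Disk
  | halfPlane (u : Plane) (t : ℝ) (hu : ‖u‖ = 1) : Disk

namespace Disk

/-- The points of the plane that belong to the disk. -/
def region : Disk → Set Plane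
  | inside c r _ => {p | dist p c ≤ r}
  | outside c r _ => {p | r ≤ dist p c}
  | halfPlane u t _ => {p | inner ℝ u p ≤ t}

/-- The bend: the curvature of the bounding circle, negative for the exterior of a circle and zero
for a half-plane. -/
noncomputable def bend : Disk → ℝ
  | inside _ r _ => 1 / r
  | outside _ r _ => -(1 / r)
  | halfPlane _ _ _ => 0

/-- The closed disk as a subset of the Riemann sphere (the one-point compactification of the plane):
exteriors of circles and half-planes also contain the point at infinity. -/
def sphereRegion (D : Disk) : Set (OnePoint Plane) :=
  ((↑) '' D.region) ∪ {x | x = OnePoint.infty ∧ D.bend ≤ 0}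

/-- Two disks are tangent (without overlapping) when, on the sphere, they share exactly one point.
Two disjoint parallel half-planes are tangent at infinity. -/
def Tangent (D E : Disk) : Prop :=
  ∃ x, D.sphereRegion ∩ E.sphereRegion = {x}

end Disk

/-- Four pairwise tangent disks (a Descartes configuration). -/
def IsDescartes (q : Fin 4 → Disk) : Prop :=
  ∀ i j, i ≠ j → (q i).Tangent (q j)

/-- The Descartes configurations obtained from `q` by repeatedly replacing one of the four disks
by a disk tangent to the other three, that is, by inscribing a new disk in an ideal triangle. -/
inductive Generates (q : Fin 4 → Disk) : (Fin 4 → Disk) → Prop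
  | start : Generates q q
  | inscribe (p : Fin 4 → Disk) (i : Fin 4) (D : Disk) (hp : Generates q p)
      (hD : ∀ j, j ≠ i → D.Tangent (p j)) : Generates q (Function.update p i D)

/-- All disks that occur in the construction started from `q`. -/
def gasketOf (q : Fin 4 → Disk) : Set Disk :=
  {D | ∃ p, Generates q p ∧ ∃ i, p i = D}

/-- An Apollonian gasket: the packing generated by a Descartes configuration in which one of the
bounding circles (possibly a line) has all the other disks on one side, so that the corresponding
disk is the exterior of that circle or a half-plane. -/
def IsGasket (G : Set Disk) : Prop :=
  ∃ q : Fin 4 → Disk, IsDescartes q ∧ (q 0).bend ≤ 0 ∧ G = gasketOf q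

/-- Every bend is an integer. -/
def IsIntegral (G : Set Disk) : Prop :=
  ∀ D ∈ G, ∃ z : ℤ, D.bend = z

/-- The (integer) bends have no common factor except `1`. -/
def IsIrreducible (G : Set Disk) : Prop :=
  ∀ d : ℕ, (∀ D ∈ G, ∃ z : ℤ, D.bend = d * z) → d = 1

/-- `b` lists, in nondecreasing order and with multiplicity, the five least bends of `G`. -/
def HasMajorBends (G : Set Disk) (b : Fin 5 → ℤ) : Prop :=
  Monotone b ∧ ∃ D : Fin 5 → Disk, Function.Injective D ∧
    (∀ i, D i ∈ G ∧ (D i).bend = b i) ∧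
    ∀ E ∈ G, E ∉ Set.range D → ∀ i, (b i : ℝ) ≤ E.bend

/-- Two families of disks are congruent when an isometry of the plane (possibly a reflection)
carries the disks of the first onto the disks of the second. -/
def Congruent (G G' : Set Disk) : Prop :=
  ∃ f : Plane ≃ᵢ Plane, (fun D : Disk => f '' D.region) '' G = Disk.region '' G'

theorem congruent_refl (G : Set Disk) : Congruent G G :=
  ⟨IsometryEquiv.refl Plane, Set.image_congr fun _ _ => Set.image_id _⟩

theorem congruent_symm {G G' : Set Disk} (h : Congruent G G') : Congruent G' G := by
  obtain ⟨f, hf⟩ := h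
  refine ⟨f.symm, ?_⟩
  have h1 : (fun D : Disk => f.symm '' D.region) '' G'
      = (fun s : Set Plane => f.symm '' s) '' (Disk.region '' G') := by
    rw [Set.image_image]
  rw [h1, ← hf, Set.image_image]
  refine Set.image_congr fun D _ => ?_
  simp [Set.image_image]

theorem congruent_trans {G G' G'' : Set Disk} (h : Congruent G G') (h' : Congruent G' G'') :
    Congruent G G'' := by
  obtain ⟨f, hf⟩ := h
  obtain ⟨g, hg⟩ := h'
  refine ⟨f.trans g, ?_⟩
  have h1 : (fun D : Disk => g '' D.region) '' G'
      = (fun s : Set Plane => g '' s) '' (Disk.region '' G') := by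
    rw [Set.image_image]
  rw [← hg, h1, ← hf, Set.image_image]
  refine Set.image_congr fun D _ => ?_
  simp only [Set.image_image]
  rfl

/-- Irreducible integral Apollonian gaskets in the plane. -/
def IntegralGasket : Type :=
  {G : Set Disk // IsGasket G ∧ IsIntegral G ∧ IsIrreducible G}

/-- Gaskets are identified when they are congruent. -/
instance gasketSetoid : Setoid IntegralGasket where
  r G G' := Congruent G.1 G'.1
  iseqv := ⟨fun G => congruent_refl G.1, congruent_symm, congruent_trans⟩

/-- Irreducible quadruples of natural numbers that solve the master equation and
satisfy the constraints. -/
structure MasterSolution : Type where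
  B : ℕ
  k : ℕ
  n : ℕ
  μ : ℕ
  equation : B ^ 2 + μ ^ 2 = k * n
  mu_nonneg : 0 ≤ μ
  mu_le : (μ : ℝ) ≤ B / Real.sqrt 3
  two_mu_le : 2 * μ ≤ k
  k_le : k ≤ n
  irreducible : Nat.gcd (Nat.gcd B k) (Nat.gcd n μ) = 1

/-- The quintet of bends attached to a solution. -/
def MasterSolution.quintet (s : MasterSolution) : Fin 5 → ℤ :=
  ![-s.B, s.B + s.k, s.B + s.n, s.B + s.k + s.n - 2 * s.μ, s.B + s.k + s.n + 2 * s.μ]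

end Apollonian

open Filter Topology

/-! ### The Lorentzian form and the Gram matrix of four tangent disks -/

namespace Apollonian

/-! Generalized disks are exactly the vectors of norm 1 for a Lorentzian form on `ℝ⁴`, and points of
the plane are null vectors of bend 1. Tangency means product `-1` together with a choice of half of
the light cone (`Disk.tangent_iff`), so a Descartes configuration is a basis with Gram matrix `2I -
J`, where `J` is the all-ones matrix. Inverting this matrix gives three things: Descartes' circle
theorem; exactly two disks tangent to three given ones, with an integral linear rule for the second
bend; and rigidity, since the bends alone determine the configuration up to isometry
(`IsDescartes.exists_map_eq`).

In an integral gasket the sum of the four bends is a non-negative integer, so it has a minimum. The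
minimizing configuration, sorted, is a root. From a root, a replacement that does not undo the
previous one produces a disk at least as curved as the others in its quadruple, so the root and the
second disk tangent to its first three members carry the five least bends (`IsRoot.hasMajorBends`).
These bends are a congruence invariant.

Writing the root bends as `-B, B+k, B+n, B+k+n-2μ` turns Descartes' equation into `B² + μ² = kn`;
sortedness and minimality become the constraints. Conversely each solution is realized by explicit
vectors. -/

/-- The Lorentzian form on `ℝ⁴` in the coordinates bend, co-bend, and bend times centre. -/
noncomputable def form : (Fin 4 → ℝ) →ₗ[ℝ] (Fin 4 → ℝ) →ₗ[ℝ] ℝ :=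
  LinearMap.mk₂ ℝ (fun x y => x 2 * y 2 + x 3 * y 3 - (x 0 * y 1 + x 1 * y 0) / 2)
    (by intros; simp; ring) (by intros; simp; ring) (by intros; simp; ring)
    (by intros; simp; ring)

theorem form_apply (x y : Fin 4 → ℝ) :
    form x y = x 2 * y 2 + x 3 * y 3 - (x 0 * y 1 + x 1 * y 0) / 2 := rfl

theorem form_comm (x y : Fin 4 → ℝ) : form x y = form y x := by
  simp only [form_apply]; ring

/-- The Gram condition for four pairwise tangent disks. -/
def IsGram (v : Fin 4 → Fin 4 → ℝ) : Prop :=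
  ∀ i j, form (v i) (v j) = if i = j then 1 else -1

namespace IsGram

variable {v : Fin 4 → Fin 4 → ℝ}

theorem form_sum (hv : IsGram v) (c : Fin 4 → ℝ) (k : Fin 4) :
    form (∑ j, c j • v j) (v k) = 2 * c k - ∑ j, c j := by
  have h : ∀ j, form (v j) (v k) = if j = k then 1 else -1 := fun j => hv j k
  rw [map_sum, LinearMap.sum_apply]
  simp only [map_smul, LinearMap.smul_apply, h, smul_eq_mul]
  simp only [Fin.sum_univ_four]
  fin_cases k <;> simp <;> ring

theorem linearIndependent (hv : IsGram v) : LinearIndependent ℝ v := by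
  rw [Fintype.linearIndependent_iff]
  intro c hc
  have h : ∀ k, 2 * c k - ∑ j, c j = 0 := fun k => by rw [← hv.form_sum, hc]; simp
  simp only [Fin.sum_univ_four] at h
  have h0 := h 0
  have h1 := h 1
  have h2 := h 2
  have h3 := h 3
  intro i
  fin_cases i <;> simp <;> linarith

/-- The coefficients come from the inverse `I/2 - J/4` of the Gram matrix `2I - J`. -/
theorem reconstruct (hv : IsGram v) (x : Fin 4 → ℝ) :
    x = ∑ j, ((1 / 2) * form x (v j) - (1 / 4) * ∑ i, form x (v i)) • v j := by
  obtain ⟨c, hc⟩ : ∃ c : Fin 4 → ℝ, ∑ j, c j • v j = x := by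
    have hs : Submodule.span ℝ (Set.range v) = ⊤ :=
      hv.linearIndependent.span_eq_top_of_card_eq_finrank (by simp)
    have hx : x ∈ Submodule.span ℝ (Set.range v) := hs ▸ Submodule.mem_top
    exact (Submodule.mem_span_range_iff_exists_fun ℝ).1 hx
  have hk : ∀ k, form x (v k) = 2 * c k - ∑ j, c j := fun k => by rw [← hc, hv.form_sum]
  have hj : ∀ j, (1 / 2) * form x (v j) - (1 / 4) * ∑ i, form x (v i) = c j := by
    intro j
    simp only [hk, Fin.sum_univ_four]
    ring
  simp only [hj, hc]

theorem eq_of_form_eq (hv : IsGram v) {x y : Fin 4 → ℝ}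
    (h : ∀ i, form x (v i) = form y (v i)) : x = y := by
  rw [hv.reconstruct x, hv.reconstruct y]
  simp only [h]

theorem form_eq (hv : IsGram v) (x y : Fin 4 → ℝ) :
    form x y = ∑ j, ((1 / 2) * form x (v j) - (1 / 4) * ∑ i, form x (v i)) * form y (v j) := by
  conv_lhs => rw [hv.reconstruct x]
  rw [map_sum, LinearMap.sum_apply]
  refine Finset.sum_congr rfl fun j _ => ?_
  rw [map_smul, LinearMap.smul_apply, smul_eq_mul, form_comm (v j) y]

/-- Descartes' circle theorem. -/
theorem descartes (hv : IsGram v) :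
    2 * ∑ i, v i 0 ^ 2 = (∑ i, v i 0) ^ 2 := by
  -- This vector is null and its product with `x` is `-x 0 / 2`, so it reads off bends; expanding
  -- its zero norm in the basis is Descartes' equation.
  have h := hv.form_eq ![0, 1, 0, 0] ![0, 1, 0, 0]
  have he : ∀ x : Fin 4 → ℝ, form ![0, 1, 0, 0] x = -(x 0 / 2) := by
    intro x; rw [form_apply]; simp
  simp only [he, Fin.sum_univ_four] at h ⊢
  simp only [Matrix.cons_val_zero] at h
  linarith

/-- There are two vectors with the tangency relations to three given vectors. -/
theorem eq_or_eq (hv : IsGram v) (i : Fin 4) {x : Fin 4 → ℝ} (hx : form x x = 1)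
    (h : ∀ j, j ≠ i → form x (v j) = -1) :
    x = v i ∨ x = (2 : ℝ) • ∑ j, v j - (3 : ℝ) • v i := by
  -- With the other three products equal to `-1`, the norm condition is the quadratic `t² + 6t - 7 =
  -- 0` in the remaining product `t`.
  have key : form x (v i) = 1 ∨ form x (v i) = -7 := by
    have h1 := hv.form_eq x x
    rw [hx] at h1
    have : (form x (v i) - 1) * (form x (v i) + 7) = 0 := by
      simp only [Fin.sum_univ_four] at h1
      fin_cases i <;> simp at h <;> simp [h] at h1 <;> simp only [Fin.reduceFinMk, Fin.isValue, Fin.zero_eta, Fin.mk_one] <;>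
        linear_combination -4 * h1
    rcases mul_eq_zero.1 this with h | h
    · left; linarith
    · right; linarith
  have hg : ∀ j, form (v i) (v j) = if i = j then 1 else -1 := hv i
  have hs : ∀ j, form (∑ j, v j) (v j) = -2 := by
    intro j
    have := hv.form_sum (fun _ => 1) j
    simp only [one_smul] at this
    rw [this]; simp; norm_num
  rcases key with k | k
  · left
    refine hv.eq_of_form_eq fun j => ?_
    rw [hg]
    split_ifs with hj
    · rw [← hj, k]
    · exact h j (Ne.symm hj)
  · right
    refine hv.eq_of_form_eq fun j => ?_
    rw [map_sub, LinearMap.sub_apply, map_smul, map_smul, LinearMap.smul_apply,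
      LinearMap.smul_apply, hs, hg]
    split_ifs with hj
    · rw [← hj, k]; norm_num
    · rw [h j (Ne.symm hj)]; norm_num

theorem form_other (hv : IsGram v) (i j : Fin 4) :
    form ((2 : ℝ) • ∑ j, v j - (3 : ℝ) • v i) (v j) = if i = j then -7 else -1 := by
  have := hv.form_sum (fun _ => 1) j
  simp only [one_smul] at this
  rw [map_sub, LinearMap.sub_apply, map_smul, map_smul, LinearMap.smul_apply,
    LinearMap.smul_apply, this, hv]
  split_ifs <;> norm_num

theorem form_other_self (hv : IsGram v) (i : Fin 4) :
    form ((2 : ℝ) • ∑ j, v j - (3 : ℝ) • v i) ((2 : ℝ) • ∑ j, v j - (3 : ℝ) • v i) = 1 := by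
  rw [hv.form_eq]
  simp only [hv.form_other]
  simp only [Fin.sum_univ_four]
  fin_cases i <;> simp <;> norm_num

end IsGram

/-- Two null vectors with negative product lie on the same half of the light cone. -/
theorem pos_of_form_neg {x y : Fin 4 → ℝ} (hx : form x x = 0) (hy : form y y = 0)
    (hxy : form x y < 0) (h : 0 < x 0 + x 1) : 0 < y 0 + y 1 := by
  rw [form_apply] at hx hy hxy
  by_contra! hc
  have hx' : x 0 * x 1 = x 2 ^ 2 + x 3 ^ 2 := by linarith
  have hy' : y 0 * y 1 = y 2 ^ 2 + y 3 ^ 2 := by linarith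
  have x0 : 0 ≤ x 0 ∧ 0 ≤ x 1 := by constructor <;> nlinarith [sq_nonneg (x 2), sq_nonneg (x 3)]
  have y0 : y 0 ≤ 0 ∧ y 1 ≤ 0 := by constructor <;> nlinarith [sq_nonneg (y 2), sq_nonneg (y 3)]
  obtain ⟨a0, a1⟩ := x0
  obtain ⟨c0, c1⟩ := y0
  -- If `y` were in the opposite half, Cauchy–Schwarz on the last two coordinates would force a
  -- non-negative product.
  have hcs : (x 2 * y 2 + x 3 * y 3) ^ 2 ≤ (x 0 * x 1) * (y 0 * y 1) := by
    rw [hx', hy']; nlinarith [sq_nonneg (x 2 * y 3 - x 3 * y 2)]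
  have h2 : (x 2 * y 2 + x 3 * y 3) ^ 2 ≤ ((x 0 * y 1 + x 1 * y 0) / 2) ^ 2 := by
    nlinarith [sq_nonneg (x 0 * y 1 - x 1 * y 0)]
  have h3 : (x 0 * y 1 + x 1 * y 0) / 2 ≤ 0 := by nlinarith
  have h4 := sq_le_sq.1 h2
  rw [abs_of_nonpos h3] at h4
  have := neg_abs_le (x 2 * y 2 + x 3 * y 3)
  linarith

/-! ### Disks as unit vectors -/

theorem plane_ext {p q : Plane} (h0 : p 0 = q 0) (h1 : p 1 = q 1) : p = q := by
  ext i
  fin_cases i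
  · exact h0
  · exact h1

theorem normal_sq {u : Plane} (hu : ‖u‖ = 1) : u 0 ^ 2 + u 1 ^ 2 = 1 := by
  have := EuclideanSpace.real_norm_sq_eq u
  rw [hu, Fin.sum_univ_two] at this
  linarith

namespace Disk

/-- The vector of a disk: bend, co-bend, and bend times centre. -/
noncomputable def vec : Disk → Fin 4 → ℝ
  | inside c r _ => ![1 / r, (c 0 ^ 2 + c 1 ^ 2 - r ^ 2) / r, c 0 / r, c 1 / r]
  | outside c r _ => ![-(1 / r), -((c 0 ^ 2 + c 1 ^ 2 - r ^ 2) / r), -(c 0 / r), -(c 1 / r)]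
  | halfPlane u t _ => ![0, -2 * t, -u 0, -u 1]

theorem vec_zero (D : Disk) : D.vec 0 = D.bend := by
  cases D <;> simp [vec, bend]

theorem form_vec_self (D : Disk) : form D.vec D.vec = 1 := by
  rw [form_apply]
  cases D with
  | inside c r hr => simp [vec]; field_simp; ring
  | outside c r hr => simp [vec]; field_simp; ring
  | halfPlane u t hu => simp [vec]; linarith [normal_sq hu]

theorem exists_vec_eq {v : Fin 4 → ℝ} (hv : form v v = 1) : ∃ D : Disk, D.vec = v := by
  rw [form_apply] at hv
  rcases lt_trichotomy (v 0) 0 with h | h | h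
  · refine ⟨outside !₂[v 2 / v 0, v 3 / v 0] (-(v 0)⁻¹) (by simpa using h), ?_⟩
    have h0 := h.ne
    funext i
    fin_cases i <;> simp [vec] <;> field_simp
    linarith
  · refine ⟨halfPlane !₂[-v 2, -v 3] (-v 1 / 2) ?_, ?_⟩
    · rw [EuclideanSpace.norm_eq]
      simp
      rw [h] at hv
      linarith
    · funext i
      fin_cases i <;> simp [vec, h]
      ring
  · refine ⟨inside !₂[v 2 / v 0, v 3 / v 0] (v 0)⁻¹ (by simpa using h), ?_⟩
    have h0 := h.ne'
    funext i
    fin_cases i <;> simp [vec] <;> field_simp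
    linarith

theorem vec_injective : Function.Injective vec := by
  intro D E h
  have h0 := congrFun h 0
  have h1 := congrFun h 1
  have h2 := congrFun h 2
  have h3 := congrFun h 3
  cases D with
  | inside c r hr =>
    cases E with
    | inside c' r' hr' =>
      simp [vec] at h0 h2 h3
      subst h0
      rw [div_left_inj' hr.ne'] at h2 h3
      rw [plane_ext h2 h3]
    | outside c' r' hr' =>
      simp [vec] at h0
      have := inv_pos.2 hr
      have := inv_pos.2 hr'
      linarith
    | halfPlane u t hu =>
      simp [vec] at h0
      exact absurd h0 hr.ne'
  | outside c r hr =>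
    cases E with
    | outside c' r' hr' =>
      simp [vec] at h0 h2 h3
      subst h0
      rw [div_left_inj' hr.ne'] at h2 h3
      rw [plane_ext h2 h3]
    | inside c' r' hr' =>
      simp [vec] at h0
      have := inv_pos.2 hr
      have := inv_pos.2 hr'
      linarith
    | halfPlane u t hu =>
      simp [vec] at h0
      exact absurd h0 hr.ne'
  | halfPlane u t hu =>
    cases E with
    | outside c' r' hr' =>
      simp [vec] at h0
      exact absurd h0 hr'.ne'
    | inside c' r' hr' =>
      simp [vec] at h0
      exact absurd h0 hr'.ne
    | halfPlane u t hu =>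
      simp [vec] at h1 h2 h3
      subst h1
      congr 1
      exact plane_ext h2 h3

end Disk

/-! ### Points as null vectors, and membership in a disk -/

/-- The null vector of a point of the plane. -/
noncomputable def lift (p : Plane) : Fin 4 → ℝ := ![1, p 0 ^ 2 + p 1 ^ 2, p 0, p 1]

theorem form_lift (v : Fin 4 → ℝ) (p : Plane) :
    form v (lift p) = v 2 * p 0 + v 3 * p 1 - (v 0 * (p 0 ^ 2 + p 1 ^ 2) + v 1) / 2 := by
  rw [form_apply]; simp [lift]

theorem dist_sq (p q : Plane) : dist p q ^ 2 = (p 0 - q 0) ^ 2 + (p 1 - q 1) ^ 2 := by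
  rw [EuclideanSpace.dist_sq_eq, Fin.sum_univ_two, Real.dist_eq, Real.dist_eq, sq_abs, sq_abs]

theorem form_lift_lift (p q : Plane) : form (lift p) (lift q) = -(dist p q ^ 2 / 2) := by
  rw [form_lift, dist_sq]; simp [lift]; ring

theorem lift_injective : Function.Injective lift := fun p q h =>
  plane_ext (by simpa [lift] using congrFun h 2) (by simpa [lift] using congrFun h 3)

theorem Disk.mem_region (D : Disk) (p : Plane) : p ∈ D.region ↔ 0 ≤ form D.vec (lift p) := by
  rw [form_lift]
  cases D with
  | inside c r hr =>
    have h : dist p c ≤ r ↔ dist p c ^ 2 ≤ r ^ 2 := (sq_le_sq₀ dist_nonneg hr.le).symm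
    have e : c 0 / r * p 0 + c 1 / r * p 1
        - (1 / r * (p 0 ^ 2 + p 1 ^ 2) + (c 0 ^ 2 + c 1 ^ 2 - r ^ 2) / r) / 2
        = (r ^ 2 - dist p c ^ 2) / (2 * r) := by
      rw [dist_sq]; field_simp; ring
    simp only [region, vec, Set.mem_ofPred_eq, h]
    simp only [Matrix.cons_val]
    rw [e, le_div_iff₀ (by positivity), zero_mul, sub_nonneg]
  | outside c r hr =>
    have h : r ≤ dist p c ↔ r ^ 2 ≤ dist p c ^ 2 := (sq_le_sq₀ hr.le dist_nonneg).symm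
    have e : -(c 0 / r) * p 0 + -(c 1 / r) * p 1
        - (-(1 / r) * (p 0 ^ 2 + p 1 ^ 2) + -((c 0 ^ 2 + c 1 ^ 2 - r ^ 2) / r)) / 2
        = (dist p c ^ 2 - r ^ 2) / (2 * r) := by
      rw [dist_sq]; field_simp; ring
    simp only [region, vec, Set.mem_ofPred_eq, h]
    simp only [Matrix.cons_val]
    rw [e, le_div_iff₀ (by positivity), zero_mul, sub_nonneg]
  | halfPlane u t hu =>
    simp only [region, vec, Set.mem_ofPred_eq, PiLp.inner_apply, Fin.sum_univ_two]
    simp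
    constructor <;> intro <;> linarith

theorem form_add_add {v w : Fin 4 → ℝ} (hv : form v v = 1) (hw : form w w = 1)
    (h : form v w = -1) : form (v + w) (v + w) = 0 := by
  simp only [map_add, LinearMap.add_apply, hv, hw, h, form_comm w v]; norm_num

theorem pos_of_null {x : Fin 4 → ℝ} (hx : form x x = 0) (h : 0 < x 0) : 0 < x 0 + x 1 := by
  rw [form_apply] at hx
  nlinarith [sq_nonneg (x 2), sq_nonneg (x 3)]

theorem nonneg_of_null {x : Fin 4 → ℝ} (hx : form x x = 0) (h : 0 < x 0 + x 1) : 0 ≤ x 0 := by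
  rw [form_apply] at hx
  nlinarith [sq_nonneg (x 2), sq_nonneg (x 3)]

/-! ### Local and asymptotic behaviour of a disk's defining function -/

theorem form_lift_move (v : Fin 4 → ℝ) (p : Plane) (ε a b : ℝ) :
    form v (lift !₂[p 0 + ε * a, p 1 + ε * b]) = form v (lift p)
      + ε * ((v 2 - v 0 * p 0) * a + (v 3 - v 0 * p 1) * b)
      - ε ^ 2 * (v 0 * (a ^ 2 + b ^ 2) / 2) := by
  simp only [form_lift]; simp; ring

/-- The vector `(v 2 - v 0 * p 0, v 3 - v 0 * p 1)` is the gradient at `p` of `form v (lift ·)`; it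
has length 1 on the boundary circle. -/
theorem gradient_sq {v : Fin 4 → ℝ} (hv : form v v = 1) (p : Plane) :
    (v 2 - v 0 * p 0) ^ 2 + (v 3 - v 0 * p 1) ^ 2 = 1 - 2 * v 0 * form v (lift p) := by
  rw [form_apply] at hv
  rw [form_lift]
  linear_combination hv

theorem form_eq_gradient (v w : Fin 4 → ℝ) (p : Plane) :
    form v w = (v 2 - v 0 * p 0) * (w 2 - w 0 * p 0) + (v 3 - v 0 * p 1) * (w 3 - w 0 * p 1)
      + v 0 * form w (lift p) + w 0 * form v (lift p) := by
  rw [form_apply, form_lift, form_lift]; ring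

theorem eventually_pos_of_small {a m : ℝ} (c : ℝ) (ha : 0 ≤ a) (h : 0 < a ∨ 0 < m) :
    ∀ᶠ ε : ℝ in 𝓝[>] 0, 0 < a + ε * m - ε ^ 2 * c := by
  rcases h with h | h
  · have : Tendsto (fun ε : ℝ => a + ε * m - ε ^ 2 * c) (𝓝[>] 0) (𝓝 (a + 0 * m - 0 ^ 2 * c)) :=
      (Continuous.tendsto (by fun_prop) _).mono_left nhdsWithin_le_nhds
    exact this.eventually_const_lt (by simpa using h)
  · have : Tendsto (fun ε : ℝ => m - ε * c) (𝓝[>] 0) (𝓝 (m - 0 * c)) :=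
      (Continuous.tendsto (by fun_prop) _).mono_left nhdsWithin_le_nhds
    filter_upwards [this.eventually_const_lt (by simpa using h), self_mem_nhdsWithin] with ε h1 h2
    have := mul_pos h2 h1
    linarith

theorem eventually_nonneg_of_large {m c : ℝ} (d : ℝ) (h : c < 0 ∨ c = 0 ∧ 0 < m) :
    ∀ᶠ R : ℝ in atTop, 0 ≤ R * m - R ^ 2 * c - d := by
  rcases h with h | ⟨rfl, h⟩
  · filter_upwards [eventually_ge_atTop 1, eventually_ge_atTop d,
      -- This threshold makes `m - R * c ≥ 1`, so that `R * (m - R * c) ≥ R ≥ d`.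
      eventually_ge_atTop ((m - 1) / c)] with R h1 h2 h3
    rw [div_le_iff_of_neg h] at h3
    nlinarith
  · filter_upwards [eventually_ge_atTop (d / m)] with R h1
    rw [div_le_iff₀ h] at h1
    linarith

theorem exists_pos_pos {v w : Fin 4 → ℝ} {p : Plane} {a b : ℝ} (hab : a ≠ 0 ∨ b ≠ 0)
    (hv : 0 ≤ form v (lift p)) (hw : 0 ≤ form w (lift p))
    (hv' : 0 < form v (lift p) ∨ 0 < (v 2 - v 0 * p 0) * a + (v 3 - v 0 * p 1) * b)
    (hw' : 0 < form w (lift p) ∨ 0 < (w 2 - w 0 * p 0) * a + (w 3 - w 0 * p 1) * b) :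
    ∃ q, q ≠ p ∧ 0 < form v (lift q) ∧ 0 < form w (lift q) := by
  obtain ⟨ε, ⟨h1, h2⟩, h3⟩ := ((eventually_pos_of_small (v 0 * (a ^ 2 + b ^ 2) / 2) hv hv').and
    (eventually_pos_of_small (w 0 * (a ^ 2 + b ^ 2) / 2) hw hw')).and self_mem_nhdsWithin |>.exists
  rw [← form_lift_move] at h1 h2
  refine ⟨_, ?_, h1, h2⟩
  intro h
  have h0 := congrArg (fun q : Plane => q 0) h
  have h1 := congrArg (fun q : Plane => q 1) h
  have h3 : ε ≠ 0 := ne_of_gt h3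
  simp [h3] at h0 h1
  tauto

theorem exists_second_zero {v : Fin 4 → ℝ} (hv : form v v = 1) {p : Plane}
    (hp : form v (lift p) = 0) : ∃ q, q ≠ p ∧ form v (lift q) = 0 := by
  have hg := gradient_sq hv p
  rw [hp] at hg
  have hne : v 2 - v 0 * p 0 ≠ 0 ∨ v 3 - v 0 * p 1 ≠ 0 := by
    by_contra! h
    rw [h.1, h.2] at hg
    norm_num at hg
  set a := v 2 - v 0 * p 0 with ha
  set b := v 3 - v 0 * p 1 with hb
  -- A line is followed along its direction; on a circle the antipode of `p` is reached, the
  -- gradient being `v 0` times the vector from `p` to the centre.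
  by_cases h0 : v 0 = 0
  · refine ⟨!₂[p 0 + 1 * b, p 1 + 1 * (-a)], ?_, ?_⟩
    · intro h
      have h0 := congrArg (fun q : Plane => q 0) h
      have h1 := congrArg (fun q : Plane => q 1) h
      simp at h0 h1
      tauto
    · rw [form_lift_move, hp, ← ha, ← hb, h0]; ring
  · refine ⟨!₂[p 0 + (2 / v 0) * a, p 1 + (2 / v 0) * b], ?_, ?_⟩
    · intro h
      have h0 := congrArg (fun q : Plane => q 0) h
      have h1 := congrArg (fun q : Plane => q 1) h
      simp at h0 h1
      tauto
    · rw [form_lift_move, hp, ← ha, ← hb]; field_simp; ring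

theorem eq_neg_of_unit {a b c d : ℝ} (h1 : a ^ 2 + b ^ 2 = 1) (h2 : c ^ 2 + d ^ 2 = 1)
    (h : a * c + b * d = -1) : c = -a ∧ d = -b := by
  have : (a + c) ^ 2 + (b + d) ^ 2 = 0 := by linear_combination h1 + h2 + 2 * h
  have h3 : a + c = 0 := by nlinarith [sq_nonneg (a + c), sq_nonneg (b + d)]
  have h4 : b + d = 0 := by nlinarith [sq_nonneg (a + c), sq_nonneg (b + d)]
  constructor <;> linarith

theorem neg_one_lt_of_unit {a b c d : ℝ} (h1 : a ^ 2 + b ^ 2 = 1) (h2 : c ^ 2 + d ^ 2 = 1)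
    (h : a * c + b * d ≠ -1) : -1 < a * c + b * d :=
  lt_of_le_of_ne (by nlinarith [sq_nonneg (a + c), sq_nonneg (b + d)]) h.symm

/-- If the interiors of two disks have no common point except possibly `p`, which lies in both disks,
then `p` is on both boundary circles, and the gradients there are opposite. -/
theorem gradient_eq_neg_of_unique {v w : Fin 4 → ℝ} (hv : form v v = 1) (hw : form w w = 1)
    {p : Plane} (hp : 0 ≤ form v (lift p)) (hq : 0 ≤ form w (lift p))
    (huniq : ∀ q, 0 < form v (lift q) → 0 < form w (lift q) → q = p) :
    form v (lift p) = 0 ∧ form w (lift p) = 0 ∧ w 2 - w 0 * p 0 = -(v 2 - v 0 * p 0) ∧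
      w 3 - w 0 * p 1 = -(v 3 - v 0 * p 1) := by
  have key : ∀ a b : ℝ, (a ≠ 0 ∨ b ≠ 0) →
      (0 < form v (lift p) ∨ 0 < (v 2 - v 0 * p 0) * a + (v 3 - v 0 * p 1) * b) →
      (0 < form w (lift p) ∨ 0 < (w 2 - w 0 * p 0) * a + (w 3 - w 0 * p 1) * b) → False := by
    intro a b hab h1 h2
    obtain ⟨q, hne, h3, h4⟩ := exists_pos_pos hab hp hq h1 h2
    exact hne (huniq q h3 h4)
  have hgv := gradient_sq hv p
  have hgw := gradient_sq hw p
  have ne_of : ∀ a b : ℝ, a ^ 2 + b ^ 2 = 1 → a ≠ 0 ∨ b ≠ 0 := by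
    intro a b h
    by_contra! hc
    rw [hc.1, hc.2] at h
    norm_num at h
  have h0 : form v (lift p) = 0 := by
    by_contra h
    have hpos := lt_of_le_of_ne hp (Ne.symm h)
    rcases hq.eq_or_lt with h' | h'
    · rw [← h', mul_zero, sub_zero] at hgw
      exact key _ _ (ne_of _ _ hgw) (Or.inl hpos) (Or.inr (by nlinarith))
    · exact key 1 0 (by simp) (Or.inl hpos) (Or.inl h')
  rw [h0, mul_zero, sub_zero] at hgv
  have h0' : form w (lift p) = 0 := by
    by_contra h
    exact key _ _ (ne_of _ _ hgv) (Or.inr (by nlinarith)) (Or.inl (lt_of_le_of_ne hq (Ne.symm h)))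
  rw [h0', mul_zero, sub_zero] at hgw
  refine ⟨h0, h0', eq_neg_of_unit hgv hgw ?_⟩
  by_contra hc
  have hlt := neg_one_lt_of_unit hgv hgw hc
  set a := v 2 - v 0 * p 0
  set b := v 3 - v 0 * p 1
  set c := w 2 - w 0 * p 0
  set d := w 3 - w 0 * p 1
  -- The sum of two unit gradients that are not opposite points into both disks.
  refine key (a + c) (b + d) ?_ (Or.inr (by nlinarith)) (Or.inr (by nlinarith))
  by_contra! hz
  nlinarith

/-- The gradients at the common point are opposite, which fixes the product. If the bends had sum at
most 0, every other boundary point of the first disk would also lie in the second. -/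
theorem bend_pos_of_unique {v w : Fin 4 → ℝ} (hv : form v v = 1) (hw : form w w = 1)
    {p : Plane} (hp : 0 ≤ form v (lift p)) (hq : 0 ≤ form w (lift p))
    (huniq : ∀ q, 0 ≤ form v (lift q) → 0 ≤ form w (lift q) → q = p) :
    form v w = -1 ∧ 0 < v 0 + w 0 := by
  obtain ⟨h1, h2, h3, h4⟩ := gradient_eq_neg_of_unique hv hw hp hq
    fun q a b => huniq q a.le b.le
  have hg := gradient_sq hv p
  constructor
  · rw [form_eq_gradient v w p, h1, h2, h3, h4]
    rw [h1] at hg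
    linear_combination -hg
  · by_contra! hc
    obtain ⟨q, hne, hz⟩ := exists_second_zero hv h1
    refine hne (huniq q hz.ge ?_)
    have e : form w (lift q) = -(v 0 + w 0) * ((q 0 - p 0) ^ 2 + (q 1 - p 1) ^ 2) / 2 := by
      rw [form_lift] at h1 h2 hz ⊢
      linear_combination h1 + h2 - hz + h3 * (q 0 - p 0) + h4 * (q 1 - p 1)
    rw [e]
    have : 0 ≤ -(v 0 + w 0) := by linarith
    positivity

/-- This is tangency at infinity. A ray eventually stays in a region of negative bend, and in a
half-plane when it points inward; disjointness therefore leaves only half-planes with opposite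
normals. -/
theorem halfPlanes_of_disjoint {v w : Fin 4 → ℝ} (hv : form v v = 1) (hw : form w w = 1)
    (hv0 : v 0 ≤ 0) (hw0 : w 0 ≤ 0)
    (hdisj : ∀ q, 0 ≤ form v (lift q) → 0 ≤ form w (lift q) → False) :
    form v w = -1 ∧ v 0 = 0 ∧ w 0 = 0 ∧ 0 < v 1 + w 1 := by
  have e : ∀ (x : Fin 4 → ℝ) (R a b : ℝ), form x (lift !₂[R * a, R * b]) =
      R * (x 2 * a + x 3 * b) - R ^ 2 * (x 0 * (a ^ 2 + b ^ 2) / 2) - x 1 / 2 := by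
    intro x R a b
    rw [form_lift]; simp; ring
  have key : ∀ a b : ℝ,
      (v 0 * (a ^ 2 + b ^ 2) / 2 < 0 ∨ v 0 * (a ^ 2 + b ^ 2) / 2 = 0 ∧ 0 < v 2 * a + v 3 * b) →
      (w 0 * (a ^ 2 + b ^ 2) / 2 < 0 ∨ w 0 * (a ^ 2 + b ^ 2) / 2 = 0 ∧ 0 < w 2 * a + w 3 * b) →
      False := by
    intro a b h1 h2
    obtain ⟨R, h3, h4⟩ := ((eventually_nonneg_of_large (v 1 / 2) h1).and
      (eventually_nonneg_of_large (w 1 / 2) h2)).exists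
    rw [← e] at h3 h4
    exact hdisj _ h3 h4
  rw [form_apply] at hv hw
  have hv00 : v 0 = 0 := by
    by_contra h
    have hneg := lt_of_le_of_ne hv0 h
    rcases hw0.eq_or_lt with h' | h'
    · rw [h'] at hw
      have h1 : w 2 ^ 2 + w 3 ^ 2 = 1 := by linarith
      exact key (w 2) (w 3) (Or.inl (by rw [h1]; linarith)) (Or.inr ⟨by rw [h']; simp, by linarith⟩)
    · exact key 1 0 (Or.inl (by linarith)) (Or.inl (by linarith))
  rw [hv00] at hv
  have h1 : v 2 ^ 2 + v 3 ^ 2 = 1 := by linarith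
  have hw00 : w 0 = 0 := by
    by_contra h
    have hneg := lt_of_le_of_ne hw0 h
    exact key (v 2) (v 3) (Or.inr ⟨by rw [hv00]; simp, by linarith⟩) (Or.inl (by rw [h1]; linarith))
  rw [hw00] at hw
  have h2 : w 2 ^ 2 + w 3 ^ 2 = 1 := by linarith
  have h3 : v 2 * w 2 + v 3 * w 3 = -1 := by
    by_contra hc
    have := neg_one_lt_of_unit h1 h2 hc
    exact key (v 2 + w 2) (v 3 + w 3) (Or.inr ⟨by rw [hv00]; simp, by linarith⟩)
      (Or.inr ⟨by rw [hw00]; simp, by linarith⟩)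
  refine ⟨by rw [form_apply, hv00, hw00]; linarith, hv00, hw00, ?_⟩
  by_contra! hc
  -- The foot of the perpendicular from the origin to the boundary line of `v`; it lies in `w` when
  -- `v 1 + w 1 ≤ 0`.
  refine hdisj !₂[v 1 / 2 * v 2, v 1 / 2 * v 3] ?_ ?_
  · rw [e, hv00]
    have : v 2 * v 2 + v 3 * v 3 = 1 := by linarith
    rw [this]; linarith
  · rw [e, hw00]
    have : w 2 * v 2 + w 3 * v 3 = -1 := by linarith
    rw [this]; linarith

/-! ### Tangency as a Lorentzian condition -/

namespace Disk

theorem coe_mem_sphereRegion (D : Disk) (p : Plane) :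
    (p : OnePoint Plane) ∈ D.sphereRegion ↔ p ∈ D.region := by
  simp [sphereRegion]

theorem infty_mem_sphereRegion (D : Disk) :
    OnePoint.infty ∈ D.sphereRegion ↔ D.bend ≤ 0 := by
  simp [sphereRegion]

/-- Tangency in terms of the Lorentzian form. -/
theorem tangent_iff (D E : Disk) : D.Tangent E ↔
    form D.vec E.vec = -1 ∧ 0 < (D.vec + E.vec) 0 + (D.vec + E.vec) 1 := by
  have hD := D.form_vec_self
  have hE := E.form_vec_self
  constructor
  · rintro ⟨x, hx⟩
    have hmem : ∀ y, y ∈ D.sphereRegion → y ∈ E.sphereRegion → y = x := by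
      intro y h1 h2
      have : y ∈ D.sphereRegion ∩ E.sphereRegion := ⟨h1, h2⟩
      rw [hx] at this
      exact this
    have hxm : x ∈ D.sphereRegion ∩ E.sphereRegion := by rw [hx]; rfl
    obtain ⟨hxD, hxE⟩ := hxm
    induction x using OnePoint.rec with
    | infty =>
      rw [infty_mem_sphereRegion, ← vec_zero] at hxD hxE
      obtain ⟨h1, h2, h3, h4⟩ := halfPlanes_of_disjoint hD hE hxD hxE fun q h1 h2 => by
        rw [← mem_region] at h1 h2
        exact OnePoint.coe_ne_infty q (hmem q ((coe_mem_sphereRegion _ _).2 h1)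
          ((coe_mem_sphereRegion _ _).2 h2))
      exact ⟨h1, by simp only [Pi.add_apply, h2, h3]; linarith⟩
    | coe p =>
      rw [coe_mem_sphereRegion, mem_region] at hxD hxE
      obtain ⟨h1, h2⟩ := bend_pos_of_unique hD hE hxD hxE fun q h1 h2 => by
        rw [← mem_region] at h1 h2
        exact OnePoint.coe_injective (hmem q ((coe_mem_sphereRegion _ _).2 h1)
          ((coe_mem_sphereRegion _ _).2 h2))
      exact ⟨h1, pos_of_null (form_add_add hD hE h1) h2⟩
  · rintro ⟨h, hpos⟩
    have hnull := form_add_add hD hE h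
    have h0 := nonneg_of_null hnull hpos
    set v := D.vec with hv
    set w := E.vec with hw
    rw [form_apply] at hnull
    simp only [Pi.add_apply] at hnull hpos h0
    -- The null vector `v + w` represents the tangency point: infinity if its bend vanishes,
    -- otherwise a positive multiple of `lift p`.
    rcases h0.eq_or_lt with h0 | h0
    · have hc : 0 < v 1 + w 1 := by linarith
      rw [← h0] at hnull
      have h2 : v 2 + w 2 = 0 := by nlinarith [sq_nonneg (v 2 + w 2), sq_nonneg (v 3 + w 3)]
      have h3 : v 3 + w 3 = 0 := by nlinarith [sq_nonneg (v 2 + w 2), sq_nonneg (v 3 + w 3)]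
      have e0 : w 0 = -v 0 := by linarith
      have e2 : w 2 = -v 2 := by linarith
      have e3 : w 3 = -v 3 := by linarith
      have hv0 : v 0 = 0 := by
        rw [form_apply, e0, e2, e3] at h
        rw [form_apply] at hD
        have : v 0 * (v 1 + w 1) = 0 := by linear_combination -2 * h - 2 * hD
        exact (mul_eq_zero.1 this).resolve_right hc.ne'
      refine ⟨OnePoint.infty, ?_⟩
      ext y
      induction y using OnePoint.rec with
      | infty =>
        simp only [Set.mem_inter_iff, infty_mem_sphereRegion, Set.mem_singleton_iff, iff_true,
          ← vec_zero, ← hv, ← hw]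
        constructor <;> linarith
      | coe p =>
        simp only [Set.mem_inter_iff, coe_mem_sphereRegion, mem_region, Set.mem_singleton_iff,
          OnePoint.coe_ne_infty, iff_false, not_and, ← hv, ← hw]
        rw [form_lift, form_lift, e0, e2, e3]
        intro h1 h2
        linarith
    · have hs := h0.ne'
      set p : Plane := !₂[(v 2 + w 2) / (v 0 + w 0), (v 3 + w 3) / (v 0 + w 0)] with hp
      have p0 : (v 0 + w 0) * p 0 = v 2 + w 2 := by simp [hp]; field_simp
      have p1 : (v 0 + w 0) * p 1 = v 3 + w 3 := by simp [hp]; field_simp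
      have hsum : ∀ q : Plane, form v (lift q) + form w (lift q)
          = -(v 0 + w 0) * ((q 0 - p 0) ^ 2 + (q 1 - p 1) ^ 2) / 2 := by
        intro q
        have hz : (v 0 + w 0) * (v 1 + w 1)
            = (v 0 + w 0) * ((v 0 + w 0) * (p 0 ^ 2 + p 1 ^ 2)) := by
          have : (v 0 + w 0) * ((v 0 + w 0) * (p 0 ^ 2 + p 1 ^ 2))
            = ((v 0 + w 0) * p 0) ^ 2 + ((v 0 + w 0) * p 1) ^ 2 := by ring
          rw [this, p0, p1]; linarith
        have hz' := mul_left_cancel₀ hs hz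
        rw [form_lift, form_lift]
        linear_combination -q 0 * p0 - q 1 * p1 - hz' / 2
      have hp2 := hsum p
      simp only [sub_self] at hp2
      have hw' : form w (lift p) = -form v (lift p) := by linarith
      have hvp : form v (lift p) = 0 := by
        have hg := gradient_sq hD p
        rw [form_eq_gradient v w p, hw'] at h
        have a0 : w 2 - w 0 * p 0 = -(v 2 - v 0 * p 0) := by linarith
        have a1 : w 3 - w 0 * p 1 = -(v 3 - v 0 * p 1) := by linarith
        rw [a0, a1] at h
        have : (v 0 + w 0) * form v (lift p) = 0 := by linear_combination h + hg
        exact (mul_eq_zero.1 this).resolve_left hs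
      refine ⟨p, ?_⟩
      ext y
      induction y using OnePoint.rec with
      | infty =>
        simp only [Set.mem_inter_iff, infty_mem_sphereRegion, Set.mem_singleton_iff,
          OnePoint.infty_ne_coe, iff_false, not_and, ← vec_zero, ← hv, ← hw]
        intro h1 h2
        linarith
      | coe q =>
        simp only [Set.mem_inter_iff, coe_mem_sphereRegion, mem_region, Set.mem_singleton_iff,
          OnePoint.coe_eq_coe, ← hv, ← hw]
        constructor
        · rintro ⟨h1, h2⟩
          have h3 := hsum q
          have h4 : (q 0 - p 0) ^ 2 + (q 1 - p 1) ^ 2 ≤ 0 := by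
            by_contra! h5
            have := mul_pos h0 h5
            linarith
          refine plane_ext ?_ ?_
          · nlinarith [sq_nonneg (q 0 - p 0), sq_nonneg (q 1 - p 1)]
          · nlinarith [sq_nonneg (q 0 - p 0), sq_nonneg (q 1 - p 1)]
        · rintro rfl
          exact ⟨hvp.ge, by rw [hw', hvp]; simp⟩

/-! ### Regions determine disks; the action of isometries -/

theorem exists_boundary (D : Disk) : ∃ p, form D.vec (lift p) = 0 := by
  have h := D.form_vec_self
  rw [form_apply] at h
  set v := D.vec
  by_cases h0 : v 0 = 0
  · refine ⟨!₂[v 1 / 2 * v 2, v 1 / 2 * v 3], ?_⟩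
    rw [h0] at h
    rw [form_lift, h0]
    simp
    linear_combination (v 1 / 2) * h
  · refine ⟨!₂[(v 2 + 1) / v 0, v 3 / v 0], ?_⟩
    rw [form_lift]
    simp
    field_simp
    linear_combination h

theorem region_injective : Function.Injective region := by
  intro D E h
  have hD := D.form_vec_self
  have hE := E.form_vec_self
  have hiff : ∀ p, 0 ≤ form D.vec (lift p) ↔ 0 ≤ form E.vec (lift p) := by
    intro p
    rw [← mem_region, ← mem_region, h]
  have hneg : form (-D.vec) (-D.vec) = 1 := by simpa using hD
  have key : ∀ p, form D.vec (lift p) = 0 → form E.vec (lift p) = 0 ∧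
      E.vec 2 - E.vec 0 * p 0 = D.vec 2 - D.vec 0 * p 0 ∧
      E.vec 3 - E.vec 0 * p 1 = D.vec 3 - D.vec 0 * p 1 := by
    intro p hp
    -- The vector `-D.vec` describes the complementary disk, whose interior misses `E`; opposite
    -- gradients there mean equal gradients for `D` and `E`. Two boundary points then separate bend
    -- from centre.
    obtain ⟨-, h1, h2, h3⟩ := gradient_eq_neg_of_unique (p := p) hneg hE (by simp [hp])
      ((hiff p).1 hp.ge) (fun q h1 h2 => by
        have := (hiff q).2 h2.le
        simp at h1
        linarith)
    simp at h2 h3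
    exact ⟨h1, by linarith, by linarith⟩
  obtain ⟨p, hp⟩ := D.exists_boundary
  obtain ⟨q, hne, hq⟩ := exists_second_zero hD hp
  obtain ⟨h1, h2, h3⟩ := key p hp
  obtain ⟨h1', h2', h3'⟩ := key q hq
  have h0 : E.vec 0 = D.vec 0 := by
    by_contra hc
    have hc' := sub_ne_zero.2 hc
    refine hne (plane_ext ?_ ?_)
    · refine mul_left_cancel₀ hc' ?_
      linarith
    · refine mul_left_cancel₀ hc' ?_
      linarith
  rw [h0] at h2 h3
  have e2 : E.vec 2 = D.vec 2 := by linarith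
  have e3 : E.vec 3 = D.vec 3 := by linarith
  refine vec_injective (funext fun i => ?_)
  fin_cases i
  · exact h0.symm
  · rw [form_lift] at h1 hp
    rw [h0, e2, e3] at h1
    simp
    linarith
  · exact e2.symm
  · exact e3.symm

theorem exists_region_eq_image (f : Plane ≃ᵢ Plane) (D : Disk) :
    ∃ E : Disk, E.region = f '' D.region ∧ E.bend = D.bend := by
  cases D with
  | inside c r hr =>
    refine ⟨inside (f c) r hr, ?_, rfl⟩
    ext p
    obtain ⟨q, rfl⟩ := f.surjective p
    rw [f.injective.mem_set_image]
    simp only [region, Set.mem_ofPred_eq, f.dist_eq]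
  | outside c r hr =>
    refine ⟨outside (f c) r hr, ?_, rfl⟩
    ext p
    obtain ⟨q, rfl⟩ := f.surjective p
    rw [f.injective.mem_set_image]
    simp only [region, Set.mem_ofPred_eq, f.dist_eq]
  | halfPlane u t hu =>
    set L := f.toRealLinearIsometryEquiv
    have hL : ∀ x, L x = f x - f 0 := fun x => f.toRealLinearIsometryEquiv_apply x
    refine ⟨halfPlane (L u) (t + inner ℝ (L u) (f 0)) (by rw [L.norm_map, hu]), ?_, rfl⟩
    ext p
    obtain ⟨q, rfl⟩ := f.surjective p
    rw [f.injective.mem_set_image]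
    have : inner ℝ (L u) (f q) = inner ℝ u q + inner ℝ (L u) (f 0) := by
      rw [← L.inner_map_map u q, hL q, inner_sub_right, sub_add_cancel]
    simp only [region, Set.mem_ofPred_eq, this, add_le_add_iff_right]

/-- The image of a disk under an isometry. -/
noncomputable def map (f : Plane ≃ᵢ Plane) (D : Disk) : Disk :=
  (exists_region_eq_image f D).choose

theorem region_map (f : Plane ≃ᵢ Plane) (D : Disk) : (D.map f).region = f '' D.region :=
  (exists_region_eq_image f D).choose_spec.1

theorem bend_map (f : Plane ≃ᵢ Plane) (D : Disk) : (D.map f).bend = D.bend :=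
  (exists_region_eq_image f D).choose_spec.2

theorem map_symm_map (f : Plane ≃ᵢ Plane) (D : Disk) : (D.map f).map f.symm = D := by
  apply region_injective
  rw [region_map, region_map, Set.image_image]
  simp

theorem map_injective (f : Plane ≃ᵢ Plane) : Function.Injective (map f) :=
  Function.LeftInverse.injective (map_symm_map f)

theorem sphereRegion_map (f : Plane ≃ᵢ Plane) (D : Disk) :
    (D.map f).sphereRegion = OnePoint.map f '' D.sphereRegion := by
  have hinj : Function.Injective (OnePoint.map f) := Option.map_injective f.injective
  ext y
  induction y using OnePoint.rec with
  | infty =>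
    rw [infty_mem_sphereRegion, bend_map, ← infty_mem_sphereRegion,
      ← OnePoint.map_infty f, hinj.mem_set_image, OnePoint.map_infty]
  | coe p =>
    obtain ⟨q, rfl⟩ := f.surjective p
    rw [coe_mem_sphereRegion, region_map, f.injective.mem_set_image, ← coe_mem_sphereRegion,
      ← OnePoint.map_some f, hinj.mem_set_image]

theorem Tangent.map {D E : Disk} (h : D.Tangent E) (f : Plane ≃ᵢ Plane) :
    (D.map f).Tangent (E.map f) := by
  obtain ⟨x, hx⟩ := h
  have hinj : Function.Injective (OnePoint.map f) := Option.map_injective f.injective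
  exact ⟨OnePoint.map f x, by
    rw [sphereRegion_map, sphereRegion_map, ← Set.image_inter hinj, hx, Set.image_singleton]⟩

end Disk

/-! ### Descartes configurations and replacement of one disk -/

theorem Disk.Tangent.symm {D E : Disk} (h : D.Tangent E) : E.Tangent D := by
  obtain ⟨x, hx⟩ := h
  exact ⟨x, by rw [Set.inter_comm, hx]⟩

theorem Disk.not_tangent_self (D : Disk) : ¬ D.Tangent D := by
  intro h
  have h1 := ((D.tangent_iff D).1 h).1
  rw [D.form_vec_self] at h1
  norm_num at h1

theorem Disk.Tangent.bend_add_nonneg {D E : Disk} (h : D.Tangent E) : 0 ≤ D.bend + E.bend := by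
  obtain ⟨h1, h2⟩ := (D.tangent_iff E).1 h
  have := nonneg_of_null (form_add_add D.form_vec_self E.form_vec_self h1) h2
  rwa [Pi.add_apply, Disk.vec_zero, Disk.vec_zero] at this

theorem isDescartes_of_gram {q : Fin 4 → Disk} (hq : IsGram fun i => (q i).vec)
    (hpos : ∀ i j, i ≠ j → 0 < ((q i).vec + (q j).vec) 0 + ((q i).vec + (q j).vec) 1) :
    IsDescartes q := fun i j hij =>
  (Disk.tangent_iff _ _).2 ⟨(hq i j).trans (if_neg hij), hpos i j hij⟩

namespace IsDescartes

variable {q : Fin 4 → Disk}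

theorem gram (hq : IsDescartes q) : IsGram fun i => (q i).vec := by
  intro i j
  split_ifs with h
  · rw [h]; exact (q j).form_vec_self
  · exact ((Disk.tangent_iff _ _).1 (hq i j h)).1

theorem injective (hq : IsDescartes q) : Function.Injective q := by
  intro i j h
  by_contra hij
  have := hq i j hij
  rw [h] at this
  exact Disk.not_tangent_self _ this

theorem bend_descartes (hq : IsDescartes q) :
    2 * ∑ i, (q i).bend ^ 2 = (∑ i, (q i).bend) ^ 2 := by
  have := hq.gram.descartes
  simpa only [Disk.vec_zero] using this

/-- There is a second disk tangent to three disks of a Descartes configuration. -/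
theorem exists_other (hq : IsDescartes q) (i : Fin 4) : ∃ D : Disk, D ≠ q i ∧
    (∀ j, j ≠ i → D.Tangent (q j)) ∧ D.bend = 2 * ∑ j, (q j).bend - 3 * (q i).bend := by
  obtain ⟨D, hD⟩ := Disk.exists_vec_eq (hq.gram.form_other_self i)
  have hf := hq.gram.form_other i
  rw [← hD] at hf
  refine ⟨D, ?_, ?_, ?_⟩
  · rintro rfl
    have := hf i
    rw [Disk.form_vec_self, if_pos rfl] at this
    norm_num at this
  · intro k hk
    have hk1 : form D.vec (q k).vec = -1 := (hf k).trans (if_neg (Ne.symm hk))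
    refine (Disk.tangent_iff _ _).2 ⟨hk1, ?_⟩
    obtain ⟨j, l, hji, hjk, hli, hlk, hjl⟩ :
        ∃ j l : Fin 4, j ≠ i ∧ j ≠ k ∧ l ≠ i ∧ l ≠ k ∧ j ≠ l := by
      clear hk1 hf hD
      revert i k
      decide
    obtain ⟨h1, h2⟩ := (Disk.tangent_iff _ _).1 (hq j l hjl)
    -- The tangency points of `q j, q l` and of `D, q k` are null vectors with product `-4`, hence
    -- on the same half of the cone.
    refine pos_of_form_neg (form_add_add (q j).form_vec_self (q l).form_vec_self h1)
      (form_add_add D.form_vec_self (q k).form_vec_self hk1) ?_ h2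
    have a1 : form (q j).vec D.vec = -1 :=
      (form_comm _ _).trans ((hf j).trans (if_neg (Ne.symm hji)))
    have a2 : form (q l).vec D.vec = -1 :=
      (form_comm _ _).trans ((hf l).trans (if_neg (Ne.symm hli)))
    have a3 : form (q j).vec (q k).vec = -1 := (hq.gram j k).trans (if_neg hjk)
    have a4 : form (q l).vec (q k).vec = -1 := (hq.gram l k).trans (if_neg hlk)
    simp only [map_add, LinearMap.add_apply, a1, a2, a3, a4]
    norm_num
  · rw [← Disk.vec_zero, hD]
    simp [Disk.vec_zero, Finset.sum_apply]

theorem vec_eq_of_ne (hq : IsDescartes q) {i : Fin 4} {D : Disk} (hD : D ≠ q i)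
    (h : ∀ j, j ≠ i → D.Tangent (q j)) :
    D.vec = (2 : ℝ) • ∑ j, (q j).vec - (3 : ℝ) • (q i).vec :=
  (hq.gram.eq_or_eq i D.form_vec_self fun j hj =>
    ((Disk.tangent_iff _ _).1 (h j hj)).1).resolve_left fun e => hD (Disk.vec_injective e)

theorem bend_of_ne (hq : IsDescartes q) {i : Fin 4} {D : Disk} (hD : D ≠ q i)
    (h : ∀ j, j ≠ i → D.Tangent (q j)) :
    D.bend = 2 * ∑ j, (q j).bend - 3 * (q i).bend := by
  rw [← Disk.vec_zero, hq.vec_eq_of_ne hD h]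
  simp [Disk.vec_zero, Finset.sum_apply]

theorem eq_of_ne (hq : IsDescartes q) {i : Fin 4} {D E : Disk} (hD : D ≠ q i) (hE : E ≠ q i)
    (hD' : ∀ j, j ≠ i → D.Tangent (q j)) (hE' : ∀ j, j ≠ i → E.Tangent (q j)) : D = E :=
  Disk.vec_injective ((hq.vec_eq_of_ne hD hD').trans (hq.vec_eq_of_ne hE hE').symm)

theorem update (hq : IsDescartes q) {i : Fin 4} {D : Disk}
    (h : ∀ j, j ≠ i → D.Tangent (q j)) : IsDescartes (Function.update q i D) := by
  intro j k hjk
  by_cases hj : j = i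
  · subst hj
    rw [Function.update_self, Function.update_of_ne hjk.symm]
    exact h k hjk.symm
  · rw [Function.update_of_ne hj]
    by_cases hk : k = i
    · subst hk
      rw [Function.update_self]
      exact (h j hj).symm
    · rw [Function.update_of_ne hk]
      exact hq j k hjk

theorem comp (hq : IsDescartes q) (σ : Equiv.Perm (Fin 4)) : IsDescartes (q ∘ σ) :=
  fun _ _ hij => hq _ _ (σ.injective.ne hij)

end IsDescartes

/-! ### Generation of the gasket -/

namespace Generates

variable {q p r : Fin 4 → Disk}

theorem isDescartes (h : Generates q p) (hq : IsDescartes q) : IsDescartes p := by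
  induction h with
  | start => exact hq
  | inscribe p i D _ hD ih => exact ih.update hD

theorem trans (h : Generates q p) (h' : Generates p r) : Generates q r := by
  induction h' with
  | start => exact h
  | inscribe p i D _ hD ih => exact ih.inscribe _ i D hD

theorem symm (h : Generates q p) (hq : IsDescartes q) : Generates p q := by
  induction h with
  | start => exact .start
  | inscribe p i D hp hD ih =>
    refine Generates.trans ?_ ih
    have h := Generates.inscribe (q := Function.update p i D) _ i (p i) .start fun j hj => by
      rw [Function.update_of_ne hj]
      exact hp.isDescartes hq i j hj.symm
    rwa [Function.update_idem, Function.update_eq_self] at h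

theorem comp (h : Generates q p) (σ : Equiv.Perm (Fin 4)) : Generates (q ∘ σ) (p ∘ σ) := by
  induction h with
  | start => exact .start
  | inscribe p i D _ hD ih =>
    rw [Function.update_comp_equiv]
    refine ih.inscribe _ _ D fun j hj => hD _ fun h => hj ?_
    rw [← h, Equiv.symm_apply_apply]

theorem map (h : Generates q p) (f : Plane ≃ᵢ Plane) :
    Generates (fun i => (q i).map f) (fun i => (p i).map f) := by
  induction h with
  | start => exact .start
  | inscribe p i D _ hD ih =>
    have := ih.inscribe _ i (D.map f) fun j hj => (hD j hj).map f
    convert this using 1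
    funext j
    by_cases hj : j = i
    · subst hj; simp
    · simp [Function.update_of_ne hj]

/-- The replacement rule for bends is linear with integer coefficients. -/
theorem bend_dvd {d : ℝ} (h : Generates q p) (hq : IsDescartes q)
    (hb : ∀ i, ∃ z : ℤ, (q i).bend = d * z) : ∀ i, ∃ z : ℤ, (p i).bend = d * z := by
  induction h with
  | start => exact hb
  | inscribe p i D hp hD ih =>
    intro j
    by_cases hj : j = i
    · subst hj
      rw [Function.update_self]
      by_cases hne : D = p j
      · rw [hne]; exact ih j
      · choose z hz using ih
        refine ⟨2 * ∑ j, z j - 3 * z j, ?_⟩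
        rw [(hp.isDescartes hq).bend_of_ne hne hD]
        simp only [hz, ← Finset.mul_sum]
        push_cast
        ring
    · rw [Function.update_of_ne hj]; exact ih j

end Generates

theorem gasketOf_eq {q p : Fin 4 → Disk} (h : Generates q p) (hq : IsDescartes q) :
    gasketOf q = gasketOf p := by
  ext D
  constructor
  · rintro ⟨r, hr, hD⟩
    exact ⟨r, (h.symm hq).trans hr, hD⟩
  · rintro ⟨r, hr, hD⟩
    exact ⟨r, h.trans hr, hD⟩

theorem gasketOf_comp (q : Fin 4 → Disk) (σ : Equiv.Perm (Fin 4)) :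
    gasketOf (q ∘ σ) = gasketOf q := by
  have key : ∀ (q : Fin 4 → Disk) (σ : Equiv.Perm (Fin 4)), gasketOf q ⊆ gasketOf (q ∘ σ) := by
    rintro q σ D ⟨p, hp, i, hi⟩
    exact ⟨p ∘ σ, hp.comp σ, σ.symm i, by simpa using hi⟩
  refine (key q σ).antisymm' ?_
  have := key (q ∘ σ) σ.symm
  rwa [Function.comp_assoc, Equiv.self_comp_symm, Function.comp_id] at this

theorem gasketOf_map (q : Fin 4 → Disk) (f : Plane ≃ᵢ Plane) :
    gasketOf (fun i => (q i).map f) = Disk.map f '' gasketOf q := by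
  ext D
  constructor
  · rintro ⟨p, hp, i, rfl⟩
    refine ⟨(p i).map f.symm, ⟨fun i => (p i).map f.symm, ?_, i, rfl⟩, ?_⟩
    · have := hp.map f.symm
      simpa only [Disk.map_symm_map] using this
    · have := Disk.map_symm_map f.symm (p i)
      rwa [IsometryEquiv.symm_symm] at this
  · rintro ⟨E, ⟨p, hp, i, rfl⟩, rfl⟩
    exact ⟨_, hp.map f, i, rfl⟩

/-! ### Congruence and invariance of the major bends -/

theorem congruent_iff {G G' : Set Disk} :
    Congruent G G' ↔ ∃ f : Plane ≃ᵢ Plane, G' = Disk.map f '' G := by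
  refine exists_congr fun f => ?_
  have : (fun D : Disk => f '' D.region) '' G = Disk.region '' (Disk.map f '' G) := by
    rw [Set.image_image]
    exact Set.image_congr fun D _ => (Disk.region_map f D).symm
  rw [this, Disk.region_injective.image_injective.eq_iff]
  exact eq_comm

theorem bend_dvd_of_mem {q : Fin 4 → Disk} (hq : IsDescartes q) {d : ℝ}
    (hb : ∀ i, ∃ z : ℤ, (q i).bend = d * z) {D : Disk} (hD : D ∈ gasketOf q) :
    ∃ z : ℤ, D.bend = d * z := by
  obtain ⟨p, hp, i, rfl⟩ := hD
  exact hp.bend_dvd hq hb i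

theorem mem_gasketOf (q : Fin 4 → Disk) (i : Fin 4) : q i ∈ gasketOf q := ⟨q, .start, i, rfl⟩

/-- Transport of major bends under congruence. -/
theorem HasMajorBends.congruent {G G' : Set Disk} {b : Fin 5 → ℤ} (h : HasMajorBends G b)
    (hG : Congruent G G') : HasMajorBends G' b := by
  obtain ⟨f, rfl⟩ := congruent_iff.1 hG
  obtain ⟨hb, D, hinj, hD, hE⟩ := h
  refine ⟨hb, fun i => (D i).map f, (Disk.map_injective f).comp hinj,
    fun i => ⟨⟨_, (hD i).1, rfl⟩, (Disk.bend_map f _).trans (hD i).2⟩, ?_⟩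
  rintro _ ⟨E, hEG, rfl⟩ hne i
  rw [Disk.bend_map]
  refine hE E hEG ?_ i
  rintro ⟨j, rfl⟩
  exact hne ⟨j, rfl⟩

/-- The quintet of major bends is unique. -/
theorem HasMajorBends.unique {G : Set Disk} {b b' : Fin 5 → ℤ} (h : HasMajorBends G b)
    (h' : HasMajorBends G b') : b = b' := by
  have key : ∀ {b b' : Fin 5 → ℤ}, HasMajorBends G b → HasMajorBends G b' → ∀ i, b' i ≤ b i := by
    rintro b b' ⟨hb, D, hinj, hD, -⟩ ⟨hb', D', -, hD', hE'⟩ i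
    by_contra! hlt
    -- Disks of bend below `b' i` must occur among the `D' k` with `k < i`; pigeonhole rules out `i
    -- + 1` of them.
    have hex : ∀ j : Fin 5, j ≤ i → ∃ k, k < i ∧ D' k = D j := by
      intro j hj
      have hbj : b j < b' i := (hb hj).trans_lt hlt
      by_cases hr : D j ∈ Set.range D'
      · obtain ⟨k, hk⟩ := hr
        refine ⟨k, ?_, hk⟩
        by_contra! hik
        have h1 := hb' hik
        have h2 : b' k = b j := by
          have h3 := (hD j).2
          rw [← hk, (hD' k).2] at h3
          exact_mod_cast h3
        omega
      · have := hE' _ (hD j).1 hr i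
        rw [(hD j).2] at this
        have : b' i ≤ b j := by exact_mod_cast this
        omega
    choose! g hg hg' using hex
    have hcard := Finset.card_le_card_of_injOn (s := Finset.Iic i) (t := Finset.Iio i) g
      (fun j hj => by simpa using hg j (by simpa using hj))
      (fun j hj k hk hjk => hinj (by
        rw [← hg' j (by simpa using hj), ← hg' k (by simpa using hk), hjk]))
    simp at hcard
  exact funext fun i => le_antisymm (key h' h i) (key h h' i)

/-! ### Root configurations and the growth of bends -/

/-- The Descartes configurations obtained without immediate backtracking, each with the index of the
last inscribed disk. -/
inductive Reduced (q : Fin 4 → Disk) : (Fin 4 → Disk) → Option (Fin 4) → Prop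
  | root : Reduced q q none
  | step (p : Fin 4 → Disk) (o : Option (Fin 4)) (i : Fin 4) (D : Disk) (hp : Reduced q p o)
      (hi : o ≠ some i) (hne : D ≠ p i) (hD : ∀ j, j ≠ i → D.Tangent (p j)) :
      Reduced q (Function.update p i D) (some i)

theorem Reduced.generates {q p : Fin 4 → Disk} {o : Option (Fin 4)} (h : Reduced q p o) :
    Generates q p := by
  induction h with
  | root => exact .start
  | step p o i D _ _ _ hD ih => exact ih.inscribe p i D hD

theorem Generates.exists_reduced {q p : Fin 4 → Disk} (h : Generates q p) (hq : IsDescartes q) :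
    ∃ o, Reduced q p o := by
  induction h with
  | start => exact ⟨none, .root⟩
  | inscribe p i D hp hD ih =>
    obtain ⟨o, ho⟩ := ih
    by_cases hne : D = p i
    · rw [hne, Function.update_eq_self]
      exact ⟨o, ho⟩
    · by_cases hi : o = some i
      · subst hi
        cases ho with
        | step p' o' _ D' hp' _ hne' hD' =>
          have hd := hp'.generates.isDescartes hq
          rw [Function.update_self] at hne
          have hD2 : ∀ j, j ≠ i → D.Tangent (p' j) := fun j hj => by
            have := hD j hj
            rwa [Function.update_of_ne hj] at this
          have : D = p' i := by
            by_contra hc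
            exact hne (hd.eq_of_ne hc hne' hD2 hD')
          rw [Function.update_idem, this, Function.update_eq_self]
          exact ⟨o', hp'⟩
      · exact ⟨some i, .step p o i D ho hi hne hD⟩

/-- A Descartes configuration that no replacement of one disk makes smaller, in order of bend. -/
structure IsRoot (q : Fin 4 → Disk) : Prop where
  isDescartes : IsDescartes q
  mono : Monotone fun i => (q i).bend
  le : (q 3).bend ≤ (q 0).bend + (q 1).bend + (q 2).bend

namespace IsRoot

variable {q p : Fin 4 → Disk}

/-- For positive bends `a ≤ b ≤ c ≤ d`, minimality gives `0 ≤ a + b + c - d ≤ a + b`, while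
Descartes' equation makes its square at least `4c(a + b)`, which is too large. -/
theorem bend_zero_nonpos (hq : IsRoot q) : (q 0).bend ≤ 0 := by
  have hd := hq.isDescartes.bend_descartes
  have h01 : (q 0).bend ≤ (q 1).bend := hq.mono (by decide)
  have h12 : (q 1).bend ≤ (q 2).bend := hq.mono (by decide)
  have h23 : (q 2).bend ≤ (q 3).bend := hq.mono (by decide)
  have h3 := hq.le
  simp only [Fin.sum_univ_four] at hd
  by_contra! h
  set a := (q 0).bend
  set b := (q 1).bend
  set c := (q 2).bend
  set d := (q 3).bend
  have h1 : (a + b + c - d) ^ 2 = 4 * (a * b + c * (a + b)) := by linear_combination hd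
  have h2 : (a + b + c - d) ^ 2 ≤ (a + b) ^ 2 := by
    apply sq_le_sq' <;> linarith
  nlinarith

/-- Induction along reduced words: the last inscribed disk has the largest bend of its quadruple,
and no new disk beats the one obtained by replacing `q 3`, the most curved member of the root. -/
theorem reduced_bound (hq : IsRoot q) {o : Option (Fin 4)} (h : Reduced q p o) :
    (o = none → p = q) ∧
    (∀ i, o = some i → 2 * ∑ j, (q j).bend - 3 * (q 3).bend ≤ (p i).bend ∧
      ∀ j, (p j).bend ≤ (p i).bend) ∧
    ∀ j, p j ∈ Set.range q ∨ 2 * ∑ j, (q j).bend - 3 * (q 3).bend ≤ (p j).bend := by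
  induction h with
  | root => exact ⟨fun _ => rfl, by simp, fun j => Or.inl ⟨j, rfl⟩⟩
  | step p o i D hp hi hne hD ih =>
    obtain ⟨ih1, ih2, ih3⟩ := ih
    have hd := hp.generates.isDescartes hq.isDescartes
    have hb := hd.bend_of_ne hne hD
    have main : 2 * ∑ j, (q j).bend - 3 * (q 3).bend ≤ D.bend ∧
        ∀ j, j ≠ i → (p j).bend ≤ D.bend := by
      cases o with
      | none =>
        obtain rfl := ih1 rfl
        have h3 : ∀ j, (p j).bend ≤ (p 3).bend := fun j => hq.mono (Fin.le_last j)
        have hle := hq.le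
        have h4 : 2 * ∑ j, (p j).bend - 3 * (p 3).bend ≤ D.bend := by
          rw [hb]; linarith [h3 i]
        refine ⟨h4, fun j _ => (h3 j).trans (le_trans ?_ h4)⟩
        rw [Fin.sum_univ_four]
        linarith
      | some k =>
        obtain ⟨h1, h2⟩ := ih2 k rfl
        have hki : k ≠ i := fun e => hi (by rw [e])
        -- The new bend is `2(p k + p j + p l) - p i` in bends; tangency gives `p j + p l ≥ 0`, and
        -- `p i ≤ p k`.
        have h4 : (p k).bend ≤ D.bend := by
          obtain ⟨j, l, hjl, hs⟩ : ∃ j l, j ≠ l ∧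
              ∑ m, (p m).bend = (p k).bend + (p i).bend + (p j).bend + (p l).bend := by
            obtain ⟨j, l, hji, hjk, hli, hlk, hjl⟩ :
                ∃ j l : Fin 4, j ≠ i ∧ j ≠ k ∧ l ≠ i ∧ l ≠ k ∧ j ≠ l := by
              clear * -
              revert i k
              decide
            refine ⟨j, l, hjl, ?_⟩
            have : (Finset.univ : Finset (Fin 4)) = {k, i, j, l} := by
              clear * - hki hji hjk hli hlk hjl
              revert i k j l
              decide
            rw [this, Finset.sum_insert (by simp [hki, hjk.symm, hlk.symm]),
              Finset.sum_insert (by simp [hji.symm, hli.symm]),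
              Finset.sum_insert (by simp [hjl]), Finset.sum_singleton]
            ring
          have h5 := (hd j l hjl).bend_add_nonneg
          have h6 := h2 i
          rw [hb, hs]
          linarith
        exact ⟨h1.trans h4, fun j _ => (h2 j).trans h4⟩
    refine ⟨by simp, ?_, ?_⟩
    · rintro _ ⟨⟩
      rw [Function.update_self]
      refine ⟨main.1, fun j => ?_⟩
      by_cases hj : j = i
      · rw [hj, Function.update_self]
      · rw [Function.update_of_ne hj]; exact main.2 j hj
    · intro j
      by_cases hj : j = i
      · rw [hj, Function.update_self]; exact Or.inr main.1
      · rw [Function.update_of_ne hj]; exact ih3 j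

/-- The five least bends of the gasket of a root configuration. -/
theorem hasMajorBends (hq : IsRoot q) {b : Fin 5 → ℤ}
    (hb : ∀ i : Fin 4, (q i).bend = b i.castSucc)
    (hb4 : b 4 = 2 * (b 0 + b 1 + b 2) - b 3) : HasMajorBends (gasketOf q) b := by
  obtain ⟨E, hne, hE, hbend⟩ := hq.isDescartes.exists_other 3
  have h0 : (q 0).bend = b 0 := hb 0
  have h1 : (q 1).bend = b 1 := hb 1
  have h2 : (q 2).bend = b 2 := hb 2
  have h3 : (q 3).bend = b 3 := hb 3
  have hβ : 2 * ∑ j, (q j).bend - 3 * (q 3).bend = b 4 := by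
    rw [hb4, Fin.sum_univ_four, h0, h1, h2, h3]; push_cast; ring
  have h01 : (q 0).bend ≤ (q 1).bend := hq.mono (by decide)
  have h12 : (q 1).bend ≤ (q 2).bend := hq.mono (by decide)
  have h23 : (q 2).bend ≤ (q 3).bend := hq.mono (by decide)
  have hle := hq.le
  rw [h0, h1] at h01
  rw [h1, h2] at h12
  rw [h2, h3] at h23
  rw [h0, h1, h2, h3] at hle
  have h01 : b 0 ≤ b 1 := by exact_mod_cast h01
  have h12 : b 1 ≤ b 2 := by exact_mod_cast h12
  have h23 : b 2 ≤ b 3 := by exact_mod_cast h23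
  have hle : b 3 ≤ b 0 + b 1 + b 2 := by exact_mod_cast hle
  have hmono : Monotone b := by
    rw [Fin.monotone_iff_le_succ]
    intro i
    fin_cases i
    · exact h01
    · exact h12
    · exact h23
    · change b 3 ≤ b 4
      omega
  have hEq : ∀ i, q i ≠ E := by
    rintro i rfl
    by_cases hi : i = 3
    · exact hne (by rw [hi])
    · exact Disk.not_tangent_self _ (hE i hi)
  refine ⟨hmono, Fin.snoc q E, ?_, ?_, ?_⟩
  · rw [Fin.snoc_injective_iff]
    refine ⟨hq.isDescartes.injective, ?_⟩
    rintro ⟨i, hi⟩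
    exact hEq i hi
  · intro i
    refine Fin.lastCases ?_ (fun j => ?_) i
    · rw [Fin.snoc_last]
      refine ⟨⟨_, Generates.start.inscribe q 3 E hE, 3, Function.update_self ..⟩, ?_⟩
      rw [hbend, hβ]
      rfl
    · rw [Fin.snoc_castSucc]
      exact ⟨mem_gasketOf q j, hb j⟩
  · rintro F ⟨p, hp, j, rfl⟩ hF i
    obtain ⟨o, ho⟩ := hp.exists_reduced hq.isDescartes
    rcases (hq.reduced_bound ho).2.2 j with h | h
    · obtain ⟨k, hk⟩ := h
      exact absurd ⟨k.castSucc, by rw [Fin.snoc_castSucc, hk]⟩ hF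
    · rw [hβ] at h
      refine le_trans ?_ h
      exact_mod_cast hmono (Fin.le_last i)

end IsRoot

/-- The sum of the four bends is an integer, non-negative because tangent pairs have non-negative
bend sum. At its minimum, replacing disk `i`, which changes the sum by `2 * ∑ - 4 * (p i).bend`,
cannot lower it. -/
theorem exists_minimal {q : Fin 4 → Disk} (hq : IsDescartes q)
    (hint : IsIntegral (gasketOf q)) :
    ∃ p, Generates q p ∧ ∀ i, 2 * (p i).bend ≤ ∑ j, (p j).bend := by
  have hsum : ∀ p, Generates q p → ∃ n : ℕ, ∑ j, (p j).bend = n := by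
    intro p hp
    have hz : ∀ i, ∃ z : ℤ, (p i).bend = z := fun i => hint _ ⟨p, hp, i, rfl⟩
    choose z hz using hz
    have h01 := (hp.isDescartes hq 0 1 (by decide)).bend_add_nonneg
    have h23 := (hp.isDescartes hq 2 3 (by decide)).bend_add_nonneg
    have h : (0 : ℝ) ≤ (∑ j, z j : ℤ) := by
      push_cast
      simp only [← hz, Fin.sum_univ_four]
      linarith
    have h : 0 ≤ ∑ j, z j := by exact_mod_cast h
    refine ⟨(∑ j, z j).toNat, ?_⟩
    rw [← Int.cast_natCast, Int.toNat_of_nonneg h]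
    simp [hz]
  have hex : ∃ n : ℕ, ∃ p, Generates q p ∧ ∑ j, (p j).bend = n := by
    obtain ⟨n, hn⟩ := hsum q .start
    exact ⟨n, q, .start, hn⟩
  classical
  obtain ⟨p, hp, hs⟩ := Nat.find_spec hex
  refine ⟨p, hp, fun i => ?_⟩
  by_contra! hlt
  obtain ⟨D, -, hD, hb⟩ := (hp.isDescartes hq).exists_other i
  have hg := hp.inscribe p i D hD
  obtain ⟨n, hn⟩ := hsum _ hg
  have hmin := Nat.find_min' hex ⟨_, hg, hn⟩
  have hmin' : ((Nat.find hex : ℕ) : ℝ) ≤ n := by exact_mod_cast hmin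
  rw [← hs, ← hn] at hmin'
  have hupd : ∑ j, (Function.update p i D j).bend = ∑ j, (p j).bend - (p i).bend + D.bend := by
    rw [← Finset.add_sum_erase _ _ (Finset.mem_univ i),
      ← Finset.add_sum_erase (Finset.univ) (fun j => (p j).bend) (Finset.mem_univ i),
      Function.update_self, Finset.sum_congr rfl fun j hj => by
        rw [Function.update_of_ne (Finset.ne_of_mem_erase hj)]]
    ring
  rw [hupd, hb] at hmin'
  linarith

theorem exists_isRoot {q : Fin 4 → Disk} (hq : IsDescartes q)
    (hint : IsIntegral (gasketOf q)) : ∃ p, IsRoot p ∧ gasketOf q = gasketOf p := by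
  obtain ⟨p, hp, hle⟩ := exists_minimal hq hint
  set σ := Tuple.sort fun i => (p i).bend
  refine ⟨p ∘ σ, ⟨(hp.isDescartes hq).comp σ, Tuple.monotone_sort fun i => (p i).bend, ?_⟩, ?_⟩
  · have h := hle (σ 3)
    rw [← Equiv.sum_comp σ, Fin.sum_univ_four] at h
    simp only [Function.comp_apply]
    linarith
  · rw [gasketOf_comp, gasketOf_eq hp hq]

/-! ### Rigidity: the bends determine a configuration up to isometry -/

/-- The linear map taking one basis to the other preserves the form. Equal bends make it preserve
the bend coordinate too, so it sends null vectors of bend 1, that is points, to points. -/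
theorem IsGram.exists_lift {v v' : Fin 4 → Fin 4 → ℝ} (hv : IsGram v) (hv' : IsGram v')
    (h0 : ∀ i, v i 0 = v' i 0) (x : Plane) :
    ∃ y : Plane, ∀ i, form (lift y) (v' i) = form (lift x) (v i) := by
  set X := ∑ j, ((1 / 2) * form (lift x) (v j) - (1 / 4) * ∑ i, form (lift x) (v i)) • v' j with hX
  have hform : ∀ k, form X (v' k) = form (lift x) (v k) := by
    intro k
    rw [hX, hv'.form_sum]
    simp only [Fin.sum_univ_four]
    ring
  have he : ∀ z : Fin 4 → ℝ, form ![0, 1, 0, 0] z = -(z 0 / 2) := by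
    intro z; rw [form_apply]; simp
  have hX0 : X 0 = 1 := by
    have h1 := hv'.form_eq X ![0, 1, 0, 0]
    have h2 := hv.form_eq (lift x) ![0, 1, 0, 0]
    simp only [hform, he, ← h0] at h1 h2
    rw [form_comm, he] at h1 h2
    rw [← h2] at h1
    simp only [lift, Matrix.cons_val_zero] at h1
    linarith
  have hnull : form X X = 0 := by
    have h1 := hv'.form_eq X X
    have h2 := hv.form_eq (lift x) (lift x)
    simp only [hform] at h1
    rw [h1, ← h2, form_lift_lift, dist_self]
    norm_num
  rw [form_apply, hX0] at hnull
  refine ⟨!₂[X 2, X 3], fun i => ?_⟩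
  rw [← hform i]
  congr 2
  funext j
  fin_cases j
  · simp [lift, hX0]
  · simp [lift]; linarith
  · simp [lift]
  · simp [lift]

/-- Descartes configurations with the same bends are congruent. -/
theorem IsDescartes.exists_map_eq {q q' : Fin 4 → Disk} (hq : IsDescartes q)
    (hq' : IsDescartes q') (h : ∀ i, (q i).bend = (q' i).bend) :
    ∃ f : Plane ≃ᵢ Plane, ∀ i, (q i).map f = q' i := by
  have h0 : ∀ i, (q i).vec 0 = (q' i).vec 0 := fun i => by
    rw [Disk.vec_zero, Disk.vec_zero, h i]
  choose φ hφ using hq.gram.exists_lift hq'.gram h0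
  choose ψ hψ using hq'.gram.exists_lift hq.gram fun i => (h0 i).symm
  have h1 : Function.LeftInverse ψ φ := fun x =>
    lift_injective (hq.gram.eq_of_form_eq fun i => by rw [hψ, hφ])
  have h2 : Function.RightInverse ψ φ := fun x =>
    lift_injective (hq'.gram.eq_of_form_eq fun i => by rw [hφ, hψ])
  have hiso : Isometry φ := by
    refine Isometry.of_dist_eq fun x y => ?_
    have e1 := hq'.gram.form_eq (lift (φ x)) (lift (φ y))
    have e2 := hq.gram.form_eq (lift x) (lift y)
    simp only [hφ] at e1
    rw [← e2, form_lift_lift, form_lift_lift] at e1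
    rw [← sq_eq_sq₀ dist_nonneg dist_nonneg]
    linarith
  refine ⟨⟨⟨φ, ψ, h1, h2⟩, hiso⟩, fun i => Disk.region_injective ?_⟩
  rw [Disk.region_map]
  ext y
  obtain ⟨x, rfl⟩ := h2.surjective y
  change φ x ∈ φ '' _ ↔ _
  rw [h1.injective.mem_set_image, Disk.mem_region, Disk.mem_region, form_comm, form_comm _ (lift _),
    hφ]

theorem congruent_of_bend_eq {q q' : Fin 4 → Disk} (hq : IsDescartes q)
    (hq' : IsDescartes q') (h : ∀ i, (q i).bend = (q' i).bend) :
    Congruent (gasketOf q) (gasketOf q') := by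
  obtain ⟨f, hf⟩ := hq.exists_map_eq hq' h
  refine congruent_iff.2 ⟨f, ?_⟩
  rw [← gasketOf_map]
  simp only [hf]

/-! ### Root bends and the master equation -/

namespace MasterSolution

theorem quintet_injective : Function.Injective quintet := by
  rintro ⟨B, k, n, μ, _, _, _, _, _, _⟩ ⟨B', k', n', μ', _, _, _, _, _, _⟩ h
  have h0 := congrFun h 0
  have h1 := congrFun h 1
  have h2 := congrFun h 2
  have h3 := congrFun h 3
  simp [quintet] at h0 h1 h2 h3
  obtain rfl : B = B' := by omega
  obtain rfl : k = k' := by omega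
  obtain rfl : n = n' := by omega
  obtain rfl : μ = μ' := by omega
  rfl

theorem quintet_four (s : MasterSolution) :
    s.quintet 4 = 2 * (s.quintet 0 + s.quintet 1 + s.quintet 2) - s.quintet 3 := by
  simp [quintet]; ring

end MasterSolution

theorem IsRoot.exists_solution {q : Fin 4 → Disk} (hq : IsRoot q) (hint : IsIntegral (gasketOf q))
    (hirr : IsIrreducible (gasketOf q)) :
    ∃ s : MasterSolution, ∀ i : Fin 4, (q i).bend = s.quintet i.castSucc := by
  choose z hz using fun i => hint _ (mem_gasketOf q i)
  have hd := hq.isDescartes.bend_descartes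
  have h0 := hq.bend_zero_nonpos
  have h01 := (hq.isDescartes 0 1 (by decide)).bend_add_nonneg
  have h12 : (q 1).bend ≤ (q 2).bend := hq.mono (by decide)
  have h23 : (q 2).bend ≤ (q 3).bend := hq.mono (by decide)
  have hle := hq.le
  simp only [hz, Fin.sum_univ_four] at hd h0 h01 h12 h23 hle
  norm_cast at hd h0 h01 h12 h23 hle
  -- Descartes' equation makes the squared sum even; this is what makes `μ = (z 0 + z 1 + z 2 - z 3)
  -- / 2` an integer.
  have heven : Even (z 0 + z 1 + z 2 + z 3) := by
    have : Even ((z 0 + z 1 + z 2 + z 3) ^ 2) := ⟨z 0 ^ 2 + z 1 ^ 2 + z 2 ^ 2 + z 3 ^ 2, by omega⟩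
    exact (Int.even_pow.1 this).1
  obtain ⟨t, ht⟩ := heven
  obtain ⟨B, hB⟩ := Int.eq_ofNat_of_zero_le (a := -z 0) (by omega)
  obtain ⟨k, hk⟩ := Int.eq_ofNat_of_zero_le (a := z 0 + z 1) (by omega)
  obtain ⟨n, hn⟩ := Int.eq_ofNat_of_zero_le (a := z 0 + z 2) (by omega)
  obtain ⟨μ, hμ⟩ := Int.eq_ofNat_of_zero_le (a := t - z 3) (by omega)
  have e0 : z 0 = -B := by omega
  have e1 : z 1 = B + k := by omega
  have e2 : z 2 = B + n := by omega
  have e3 : z 3 = B + k + n - 2 * μ := by omega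
  have heq : B ^ 2 + μ ^ 2 = k * n := by
    rw [e0, e1, e2, e3] at hd
    zify
    linarith
  have hμk : 2 * μ ≤ k := by omega
  have hkn : k ≤ n := by omega
  have hmul : (μ : ℝ) ≤ B / Real.sqrt 3 := by
    rw [le_div_iff₀ (by positivity)]
    refine (sq_le_sq₀ (by positivity) (by positivity)).1 ?_
    rw [mul_pow, Real.sq_sqrt (by norm_num)]
    -- Constraint (i) follows from (ii): `4μ² ≤ kn = B² + μ²`.
    have h3 : μ ^ 2 * 3 ≤ B ^ 2 := by nlinarith [Nat.mul_le_mul hμk (hμk.trans hkn)]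
    exact_mod_cast h3
  have hbend : ∀ i : Fin 4, (q i).bend =
      ((![-B, B + k, B + n, B + k + n - 2 * μ] : Fin 4 → ℤ) i : ℤ) := by
    intro i
    rw [hz]
    fin_cases i
    · simp [e0]
    · simp [e1]
    · simp [e2]
    · simp [e3]
  have hgcd : Nat.gcd (Nat.gcd B k) (Nat.gcd n μ) = 1 := by
    set d := Nat.gcd (Nat.gcd B k) (Nat.gcd n μ) with hd
    obtain ⟨b, hb⟩ : d ∣ B := (Nat.gcd_dvd_left _ _).trans (Nat.gcd_dvd_left _ _)
    obtain ⟨k', hk'⟩ : d ∣ k := (Nat.gcd_dvd_left _ _).trans (Nat.gcd_dvd_right _ _)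
    obtain ⟨n', hn'⟩ : d ∣ n := (Nat.gcd_dvd_right _ _).trans (Nat.gcd_dvd_left _ _)
    obtain ⟨m, hm⟩ : d ∣ μ := (Nat.gcd_dvd_right _ _).trans (Nat.gcd_dvd_right _ _)
    refine hirr d fun D hD => bend_dvd_of_mem hq.isDescartes (fun i => ?_) hD
    refine ⟨(![-b, b + k', b + n', b + k' + n' - 2 * m] : Fin 4 → ℤ) i, ?_⟩
    rw [hbend i]
    clear_value d
    subst hb hk' hn' hm
    fin_cases i <;> simp <;> ring
  refine ⟨⟨B, k, n, μ, heq, Nat.zero_le _, hmul, hμk, hkn, hgcd⟩, fun i => ?_⟩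
  rw [hbend]
  fin_cases i <;> rfl

/-- The outer circle is centred at the origin and the second disk on the first axis; tangency to the
outer circle forces each co-bend to be `(b - 2B) / B²` for bend `b`. -/
theorem exists_isDescartes_of_pos {B k n μ : ℝ} (hB : 0 < B) (hk : 0 < k) (hkn : k ≤ n)
    (hμ : 2 * μ ≤ k) (h : B ^ 2 + μ ^ 2 = k * n) :
    ∃ q : Fin 4 → Disk, IsDescartes q ∧
      ∀ i, (q i).bend = (![-B, B + k, B + n, B + k + n - 2 * μ] : Fin 4 → ℝ) i := by
  obtain rfl : n = (B ^ 2 + μ ^ 2) / k := by rw [h]; field_simp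
  set n := (B ^ 2 + μ ^ 2) / k with hn
  set v : Fin 4 → Fin 4 → ℝ := ![![-B, 1 / B, 0, 0],
    ![B + k, (k - B) / B ^ 2, k / B, 0],
    ![B + n, (n - B) / B ^ 2, (μ ^ 2 - B ^ 2) / (k * B), 2 * μ / k],
    ![B + k + n - 2 * μ, (k + n - 2 * μ - B) / B ^ 2, (k + n - 2 * μ - 2 * B ^ 2 / k) / B,
      -2 * (k - μ) / k]] with hv
  have hgram : IsGram v := by
    have hle : ∀ i j, i ≤ j → form (v i) (v j) = if i = j then 1 else -1 := by
      intro i j hij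
      rw [form_apply]
      fin_cases i <;> fin_cases j <;> simp [hv] at hij ⊢ <;> (try rw [hn]) <;> field_simp <;> ring
    intro i j
    rcases le_total i j with hij | hij
    · exact hle i j hij
    · rw [form_comm, hle j i hij]
      simp only [eq_comm]
  have hself : ∀ i, ∃ D : Disk, D.vec = v i := fun i =>
    Disk.exists_vec_eq ((hgram i i).trans (if_pos rfl))
  choose q hq using hself
  refine ⟨q, isDescartes_of_gram (by simpa only [hq] using hgram) fun i j hij => ?_, fun i => ?_⟩
  · have hself : ∀ i, form (v i) (v i) = 1 := fun i => (hgram i i).trans (if_pos rfl)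
    rw [hq, hq]
    refine pos_of_null (form_add_add (hself i) (hself j) ((hgram i j).trans (if_neg hij))) ?_
    fin_cases i <;> fin_cases j <;> simp [hv] at hij ⊢ <;> linarith
  · rw [← Disk.vec_zero, hq]
    fin_cases i <;> simp [hv]

/-- The case `B = 0`: two half-planes bounding a strip of width 2, with two tangent unit disks
inside. -/
theorem exists_isDescartes_strip :
    ∃ q : Fin 4 → Disk, IsDescartes q ∧ ∀ i, (q i).bend = (![0, 0, 1, 1] : Fin 4 → ℝ) i := by
  set v : Fin 4 → Fin 4 → ℝ := ![![0, 2, 0, 1], ![0, 2, 0, -1], ![1, 0, 1, 0], ![1, 0, -1, 0]]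
    with hv
  have hgram : IsGram v := by
    intro i j
    rw [form_apply]
    fin_cases i <;> fin_cases j <;> simp [hv]
  have hself : ∀ i, ∃ D : Disk, D.vec = v i := fun i =>
    Disk.exists_vec_eq ((hgram i i).trans (if_pos rfl))
  choose q hq using hself
  refine ⟨q, isDescartes_of_gram (by simpa only [hq] using hgram) fun i j hij => ?_, fun i => ?_⟩
  · rw [hq, hq]
    fin_cases i <;> fin_cases j <;> simp [hv] at hij ⊢ <;> norm_num
  · rw [← Disk.vec_zero, hq]
    fin_cases i <;> simp [hv]

namespace MasterSolution

theorem exists_isRoot (s : MasterSolution) :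
    ∃ q : Fin 4 → Disk, IsRoot q ∧ ∀ i : Fin 4, (q i).bend = s.quintet i.castSucc := by
  obtain ⟨B, k, n, μ, heq, -, hμB, hμk, hkn, hgcd⟩ := s
  have key : ∃ q : Fin 4 → Disk, IsDescartes q ∧
      ∀ i, (q i).bend = (![-B, B + k, B + n, B + k + n - 2 * μ] : Fin 4 → ℝ) i := by
    rcases Nat.eq_zero_or_pos B with hB | hB
    · subst hB
      have hμ : μ = 0 := by
        simp at hμB
        exact hμB
      subst hμ
      have hk : k = 0 := by
        rcases Nat.mul_eq_zero.1 (heq.symm.trans (by norm_num)) with h | h <;> omega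
      subst hk
      have hn : n = 1 := by simpa using hgcd
      subst hn
      obtain ⟨q, hq, hb⟩ := exists_isDescartes_strip
      refine ⟨q, hq, fun i => ?_⟩
      rw [hb]
      fin_cases i <;> simp
    · have hk : 0 < k := by
        rcases Nat.eq_zero_or_pos k with hk | hk
        · rw [hk] at heq
          have := pow_pos hB 2
          omega
        · exact hk
      exact exists_isDescartes_of_pos (by exact_mod_cast hB) (by exact_mod_cast hk)
        (by exact_mod_cast hkn) (by exact_mod_cast hμk) (by exact_mod_cast heq)
  obtain ⟨q, hq, hb⟩ := key
  have h0 : (q 0).bend = -B := hb 0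
  have h1 : (q 1).bend = B + k := hb 1
  have h2 : (q 2).bend = B + n := hb 2
  have h3 : (q 3).bend = B + k + n - 2 * μ := hb 3
  have hB0 : (0 : ℝ) ≤ B := B.cast_nonneg
  have hk0 : (0 : ℝ) ≤ k := k.cast_nonneg
  have hμ0 : (0 : ℝ) ≤ μ := μ.cast_nonneg
  have hμk' : 2 * (μ : ℝ) ≤ k := by exact_mod_cast hμk
  have hkn' : (k : ℝ) ≤ n := by exact_mod_cast hkn
  refine ⟨q, ⟨hq, ?_, ?_⟩, fun i => ?_⟩
  · rw [Fin.monotone_iff_le_succ]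
    intro i
    fin_cases i
    · change (q 0).bend ≤ (q 1).bend
      rw [h0, h1]; linarith
    · change (q 1).bend ≤ (q 2).bend
      rw [h1, h2]; linarith
    · change (q 2).bend ≤ (q 3).bend
      rw [h2, h3]; linarith
  · rw [h0, h1, h2, h3]; linarith
  · rw [hb]
    fin_cases i <;> simp [quintet]

end MasterSolution

theorem IsRoot.hasMajorBends_quintet {q : Fin 4 → Disk} (hq : IsRoot q) {s : MasterSolution}
    (hb : ∀ i : Fin 4, (q i).bend = s.quintet i.castSucc) :
    HasMajorBends (gasketOf q) s.quintet :=
  hq.hasMajorBends hb s.quintet_four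

theorem isIrreducible_of_bends {q : Fin 4 → Disk} (s : MasterSolution)
    (hb : ∀ i : Fin 4, (q i).bend = s.quintet i.castSucc) : IsIrreducible (gasketOf q) := by
  intro d hd
  have h : ∀ i : Fin 4, (d : ℤ) ∣ s.quintet i.castSucc := by
    intro i
    obtain ⟨z, hz⟩ := hd _ (mem_gasketOf q i)
    rw [hb] at hz
    exact ⟨z, by exact_mod_cast hz⟩
  have h0 : (d : ℤ) ∣ -s.B := h 0
  have h1 : (d : ℤ) ∣ s.B + s.k := h 1
  have h2 : (d : ℤ) ∣ s.B + s.n := h 2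
  rw [dvd_neg] at h0
  have hB : d ∣ s.B := Int.natCast_dvd_natCast.1 h0
  have hk : d ∣ s.k := Int.natCast_dvd_natCast.1 ((dvd_add_right h0).1 h1)
  have hn : d ∣ s.n := Int.natCast_dvd_natCast.1 ((dvd_add_right h0).1 h2)
  -- Only `B`, `k`, `n` are read off the bends directly; `μ² = kn - B²` is then divisible by `d²`.
  have hμ : d ∣ s.μ := by
    rw [← Nat.pow_dvd_pow_iff two_ne_zero, ← Nat.dvd_add_right (pow_dvd_pow_of_dvd hB 2),
      s.equation, sq]
    exact mul_dvd_mul hk hn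
  have := Nat.dvd_gcd (Nat.dvd_gcd hB hk) (Nat.dvd_gcd hn hμ)
  rw [s.irreducible] at this
  exact Nat.dvd_one.1 this

/-! ### The bijection -/

namespace IntegralGasket

theorem exists_root (G : IntegralGasket) : ∃ (q : Fin 4 → Disk) (s : MasterSolution), IsRoot q ∧
    G.1 = gasketOf q ∧ ∀ i : Fin 4, (q i).bend = s.quintet i.castSucc := by
  obtain ⟨G, ⟨p, hp, -, rfl⟩, hint, hirr⟩ := G
  obtain ⟨q, hq, he⟩ := exists_isRoot hp hint
  rw [he] at hint hirr
  obtain ⟨s, hs⟩ := hq.exists_solution hint hirr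
  exact ⟨q, s, hq, he, hs⟩

/-- The solution of the master equation attached to a gasket. -/
noncomputable def solution (G : IntegralGasket) : MasterSolution :=
  G.exists_root.choose_spec.choose

theorem solution_spec (G : IntegralGasket) : ∃ q, IsRoot q ∧ G.1 = gasketOf q ∧
    ∀ i : Fin 4, (q i).bend = G.solution.quintet i.castSucc :=
  ⟨_, G.exists_root.choose_spec.choose_spec⟩

theorem hasMajorBends (G : IntegralGasket) : HasMajorBends G.1 G.solution.quintet := by
  obtain ⟨q, hq, he, hb⟩ := G.solution_spec
  rw [he]
  exact hq.hasMajorBends_quintet hb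

/-- Equal solutions give root configurations with equal bends, congruent by rigidity. Conversely the
major bends are invariant under congruence, and they determine the solution whatever root was
chosen. -/
theorem solution_eq_iff {G G' : IntegralGasket} :
    G.solution = G'.solution ↔ Congruent G.1 G'.1 := by
  constructor
  · intro h
    obtain ⟨q, hq, he, hb⟩ := G.solution_spec
    obtain ⟨q', hq', he', hb'⟩ := G'.solution_spec
    rw [he, he']
    exact congruent_of_bend_eq hq.isDescartes hq'.isDescartes fun i => by rw [hb, hb', h]
  · intro h
    exact MasterSolution.quintet_injective ((G.hasMajorBends.congruent h).unique G'.hasMajorBends)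

theorem solution_surjective : Function.Surjective solution := by
  intro s
  obtain ⟨q, hq, hb⟩ := s.exists_isRoot
  have hint : IsIntegral (gasketOf q) := by
    intro D hD
    obtain ⟨z, hz⟩ := bend_dvd_of_mem (d := 1) hq.isDescartes
      (fun i => ⟨s.quintet i.castSucc, by rw [hb, one_mul]⟩) hD
    exact ⟨z, by rw [hz, one_mul]⟩
  refine ⟨⟨gasketOf q, ⟨q, hq.isDescartes, hq.bend_zero_nonpos, rfl⟩, hint,
    isIrreducible_of_bends s hb⟩, ?_⟩
  exact MasterSolution.quintet_injective
    ((hasMajorBends _).unique (hq.hasMajorBends_quintet hb))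

end IntegralGasket

end Apollonian

theorem theorem2p1 :
    ∃ e : Quotient Apollonian.gasketSetoid ≃ Apollonian.MasterSolution,
      ∀ G : Apollonian.IntegralGasket,
        Apollonian.HasMajorBends G.1 (e (Quotient.mk Apollonian.gasketSetoid G)).quintet := by
  refine ⟨Equiv.ofBijective (Quotient.lift Apollonian.IntegralGasket.solution
    fun _ _ h => Apollonian.IntegralGasket.solution_eq_iff.2 h) ⟨?_, ?_⟩, fun G => G.hasMajorBends⟩
  · intro x y
    induction x using Quotient.inductionOn
    induction y using Quotient.inductionOn
    intro h
    exact Quotient.sound (Apollonian.IntegralGasket.solution_eq_iff.1 h)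
  · intro s
    obtain ⟨G, hG⟩ := Apollonian.IntegralGasket.solution_surjective s
    exact ⟨Quotient.mk _ G, hG⟩
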